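/- Let $\mathcal A$ be an additive category and $\mathcal X\subseteq\mathcal A$ a full additive subcategory. Let $\mathcal A/[\mathcal X]$ be the factor category of $\mathcal A$ by the ideal of morphisms that factor through an object of $\mathcal X$. Let $\mathbf K^b(-)$ be the homotopy category of bounded cochain complexes, let $\mathbf K^b(\mathcal A)/\mathbf K^b(\mathcal X)$ be the Verdier quotient, and let $$\Phi\colon \mathbf K^b(\mathcal A)/\mathbf K^b(\mathcal X)\to\mathbf K^b(\mathcal A/[\mathcal X])$$ be the canonical functor, sending a complex $Z$ in $\mathcal A$ to $Z$ viewed as a complex in $\mathcal A/[\mathcal X]$. An $\mathcal X$-resolution of an object $B$ is a complex $X_B\colon\cdots\to X_B^{-2}\to X_B^{-1}\to B\to 0$ in $\mathcal A$, with $B$ in degree $0$, such that $X_B^{-i}\in\mathcal X$ for all $i\ge 1$ and $\mathrm{Hom}_{\mathcal A}(X,X_B)$ is acyclic for all $X\in\mathcal X$. An $\mathcal X$-coresolution of an object $A$ is a complex ${}_AX\colon 0\to A\to{}_AX^1\to{}_AX^2\to\cdots$, with $A$ in degree $0$, such that ${}_AX^i\in\mathcal X$ for all $i\geq 1$ and $\mathrm{Hom}_{\mathcal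 A}({}_AX,X)$ is acyclic for all $X\in\mathcal X$. If $X_B$ or ${}_AX$ exists, the lower extension group $\mathrm{Ext}_{\mathcal X,n}(A,B)$ is $H^{-n}\mathrm{Hom}_{\mathcal A}(A,X_B)$ or $H^{-n}\mathrm{Hom}_{\mathcal A}({}_AX,B)$, respectively. Assume that every object of $\mathcal A$ has an $\mathcal X$-resolution, or that every object of $\mathcal A$ has an $\mathcal X$-coresolution. Fix, for each pair of objects $A,B$, an arbitrary choice of an $\mathcal X$-resolution of $B$ or an $\mathcal X$-coresolution of $A$ from which $\mathrm{Ext}_{\mathcal X,n}(A,B)$ is computed. Then $\Phi$ is an equivalence of categories if and only if $\mathrm{Ext}_{\mathcal X,n}(A,B)=0$ for all $n\ge 1$ and all objects $A,B$ of $\mathcal A$. -/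

import Mathlib

open CategoryTheory CategoryTheory.Limits Opposite ZeroObject

universe v u v' u'

namespace BoundedHomotopy

/-! ### The bounded homotopy category `K^b(C)` of an additive category -/

section

variable (C : Type u) [Category.{v} C] [Preadditive C]

/-- A cochain complex, viewed in the homotopy category, is bounded if its terms vanish outside
a finite range of degrees. -/
def bounded : ObjectProperty (HomotopyCategory C (ComplexShape.up ℤ)) :=
  fun K => ∃ a b : ℤ, CochainComplex.IsStrictlyGE (C := C) K.as a ∧
    CochainComplex.IsStrictlyLE (C := C) K.as b

lemma bounded_iff (K : CochainComplex C ℤ) :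
    bounded C ((HomotopyCategory.quotient C (ComplexShape.up ℤ)).obj K) ↔
      ∃ a b : ℤ, K.IsStrictlyGE a ∧ K.IsStrictlyLE b := Iff.rfl

instance [HasZeroObject C] : (bounded C).ContainsZero where
  exists_zero := by
    refine ⟨(HomotopyCategory.quotient _ _).obj 0, Functor.map_isZero _ (isZero_zero _), ?_⟩
    rw [bounded_iff]
    exact ⟨0, 0, inferInstance, inferInstance⟩

instance : (bounded C).IsStableUnderShift ℤ where
  isStableUnderShiftBy n :=
    { le_shift := fun K hK => by
        obtain ⟨K : CochainComplex _ _, rfl⟩ := K.quotient_obj_surjective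
        rw [bounded_iff] at hK
        obtain ⟨a, b, _, _⟩ := hK
        rw [ObjectProperty.prop_shift_iff, HomotopyCategory.shift_quotient_obj, bounded_iff]
        exact ⟨a - n, b - n, K.isStrictlyGE_shift a n (a - n) (by lia),
          K.isStrictlyLE_shift b n (b - n) (by lia)⟩ }

instance [HasZeroObject C] [HasBinaryBiproducts C] : (bounded C).IsTriangulatedClosed₃ where
  ext₃' T hT h₁ h₂ := by
    obtain ⟨a₁, b₁, _, _⟩ := h₁
    obtain ⟨a₂, b₂, _, _⟩ := h₂
    obtain ⟨f : T.obj₁.as ⟶ T.obj₂.as, hf⟩ :=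
      (HomotopyCategory.quotient _ _).map_surjective T.mor₁
    refine ⟨_, ?_,
      ⟨Pretriangulated.Triangle.π₃.mapIso (Pretriangulated.isoTriangleOfIso₁₂ T _ hT
        (HomotopyCategory.mappingCone_triangleh_distinguished f)
        (Iso.refl _) (Iso.refl _) (by
          simp only [Iso.refl_hom]
          erw [Category.comp_id, Category.id_comp]
          exact hf.symm))⟩⟩
    refine (bounded_iff C _).2 ⟨min (a₁ - 1) a₂, max (b₁ - 1) b₂,
      CochainComplex.isStrictlyGE_mappingCone f a₁ a₂ _ (by simp) (by simp), ?_⟩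
    rw [CochainComplex.isStrictlyLE_iff]
    intro i hi
    simp only [max_lt_iff] at hi
    refine (CochainComplex.mappingCone.isZero_X_iff f i).2 ⟨CochainComplex.isZero_of_isStrictlyLE T.obj₁.as b₁ _,
      CochainComplex.isZero_of_isStrictlyLE T.obj₂.as b₂ _⟩

instance [HasZeroObject C] [HasBinaryBiproducts C] : (bounded C).IsTriangulated where
  toIsTriangulatedClosed₂ := .of_isTriangulatedClosed₃

/-- The bounded homotopy category `K^b(C)`, as a full (triangulated) subcategory of the homotopy
category of cochain complexes. -/
abbrev Kb := (bounded C).FullSubcategory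

end

section

variable {C : Type u} [Category.{v} C] [Preadditive C]
  {D : Type u'} [Category.{v'} D] [Preadditive D] (F : C ⥤ D) [F.Additive]

/-- The functor `K^b(C) ⥤ K^b(D)` which applies an additive functor `C ⥤ D` termwise. -/
def mapKb : Kb C ⥤ Kb D :=
  (bounded D).lift ((bounded C).ι ⋙ F.mapHomotopyCategory (ComplexShape.up ℤ)) (by
    rintro ⟨X, hX⟩
    obtain ⟨K, rfl⟩ := HomotopyCategory.quotient_obj_surjective X
    obtain ⟨a, b, ha, hb⟩ := (bounded_iff C K).1 hX
    exact ⟨a, b, inferInstanceAs (CochainComplex.IsStrictlyGE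
        ((F.mapHomologicalComplex _).obj K) a), inferInstanceAs (CochainComplex.IsStrictlyLE
        ((F.mapHomologicalComplex _).obj K) b)⟩)

noncomputable instance : (mapKb F).CommShift ℤ :=
  inferInstanceAs (((bounded D).lift ((bounded C).ι ⋙
    F.mapHomotopyCategory (ComplexShape.up ℤ)) _).CommShift ℤ)

instance [HasZeroObject C] [HasBinaryBiproducts C] [HasZeroObject D] [HasBinaryBiproducts D] :
    (mapKb F).IsTriangulated := by
  have : ((bounded C).ι ⋙ F.mapHomotopyCategory (ComplexShape.up ℤ)).IsTriangulated := by
    infer_instance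
  exact ObjectProperty.isTriangulated_lift (P := bounded D)
    ((bounded C).ι ⋙ F.mapHomotopyCategory (ComplexShape.up ℤ)) _

end

end BoundedHomotopy

namespace LowerExt

open BoundedHomotopy

variable {A : Type u} [Category.{v} A] [Preadditive A]

/-! ### The factor category `A/[X]` -/

section

variable (X : ObjectProperty A)

/-- Two parallel morphisms are identified when their difference factors through an object
of `X`. -/
def factorRel : HomRel A :=
  fun P Q f g => ∃ (T : A) (_ : X T) (a : P ⟶ T) (b : T ⟶ Q), f - g = a ≫ b

variable [HasBinaryBiproducts X.FullSubcategory]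

lemma factors_add {P Q T₁ T₂ : A} (h₁ : X T₁) (h₂ : X T₂) (a₁ : P ⟶ T₁) (b₁ : T₁ ⟶ Q)
    (a₂ : P ⟶ T₂) (b₂ : T₂ ⟶ Q) :
    ∃ (T : A) (_ : X T) (a : P ⟶ T) (b : T ⟶ Q), a₁ ≫ b₁ + a₂ ≫ b₂ = a ≫ b := by
  let S₁ : X.FullSubcategory := ⟨T₁, h₁⟩
  let S₂ : X.FullSubcategory := ⟨T₂, h₂⟩
  have e₁₁ := X.ι.congr_map (biprod.inl_fst (X := S₁) (Y := S₂))
  have e₂₂ := X.ι.congr_map (biprod.inr_snd (X := S₁) (Y := S₂))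
  have e₁₂ := X.ι.congr_map (biprod.inl_snd (X := S₁) (Y := S₂))
  have e₂₁ := X.ι.congr_map (biprod.inr_fst (X := S₁) (Y := S₂))
  rw [CategoryTheory.Functor.map_comp] at e₁₁ e₂₂ e₁₂ e₂₁
  rw [CategoryTheory.Functor.map_id] at e₁₁ e₂₂
  rw [CategoryTheory.Functor.map_zero] at e₁₂ e₂₁
  refine ⟨(S₁ ⊞ S₂).obj, (S₁ ⊞ S₂).property,
    a₁ ≫ X.ι.map (biprod.inl (X := S₁) (Y := S₂)) +
      a₂ ≫ X.ι.map (biprod.inr (X := S₁) (Y := S₂)),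
    X.ι.map (biprod.fst (X := S₁) (Y := S₂)) ≫ b₁ +
      X.ι.map (biprod.snd (X := S₁) (Y := S₂)) ≫ b₂, ?_⟩
  simp only [Preadditive.add_comp, Preadditive.comp_add, Category.assoc]
  rw [reassoc_of% e₁₁, reassoc_of% e₂₂, reassoc_of% e₁₂, reassoc_of% e₂₁]
  simp [S₁, S₂]

lemma factorRel_add ⦃P Q : A⦄ (f₁ f₂ g₁ g₂ : P ⟶ Q) (hf : factorRel X f₁ f₂)
    (hg : factorRel X g₁ g₂) : factorRel X (f₁ + g₁) (f₂ + g₂) := by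
  obtain ⟨T₁, h₁, a₁, b₁, e₁⟩ := hf
  obtain ⟨T₂, h₂, a₂, b₂, e₂⟩ := hg
  obtain ⟨T, hT, a, b, e⟩ := factors_add X h₁ h₂ a₁ b₁ a₂ b₂
  exact ⟨T, hT, a, b, by rw [← e, ← e₁, ← e₂]; abel⟩

variable [HasZeroObject X.FullSubcategory]

instance : Congruence (factorRel X) where
  equivalence := by
    intro P Q
    refine ⟨fun f => ?_, ?_, ?_⟩
    · exact ⟨(0 : X.FullSubcategory).obj, (0 : X.FullSubcategory).property, 0, 0, by simp⟩
    · rintro f g ⟨T, hT, a, b, h⟩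
      exact ⟨T, hT, -a, b, by rw [Preadditive.neg_comp, ← h, neg_sub]⟩
    · rintro f g k ⟨T₁, h₁, a₁, b₁, e₁⟩ ⟨T₂, h₂, a₂, b₂, e₂⟩
      obtain ⟨T, hT, a, b, e⟩ := factors_add X h₁ h₂ a₁ b₁ a₂ b₂
      exact ⟨T, hT, a, b, by rw [← e, ← e₁, ← e₂]; abel⟩
  comp_left := by
    rintro P Q R f g g' ⟨T, hT, a, b, e⟩
    exact ⟨T, hT, f ≫ a, b, by rw [← Preadditive.comp_sub, e, Category.assoc]⟩
  comp_right := by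
    rintro P Q R f f' g ⟨T, hT, a, b, e⟩
    exact ⟨T, hT, a, b ≫ g, by rw [← Preadditive.sub_comp, e, Category.assoc]⟩

/-- The factor category `A/[X]`: the objects of `A`, and morphisms of `A` modulo those which
factor through an object of `X`. -/
abbrev FactorCategory := CategoryTheory.Quotient (factorRel X)

/-- The projection functor `A ⥤ A/[X]`, `f ↦ [f]`. -/
abbrev toFactor : A ⥤ FactorCategory X := CategoryTheory.Quotient.functor (factorRel X)

instance : Preadditive (FactorCategory X) :=
  CategoryTheory.Quotient.preadditive (factorRel X) (factorRel_add X)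

instance : (toFactor X).Additive :=
  CategoryTheory.Quotient.functor_additive (factorRel X) (factorRel_add X)

instance [HasZeroObject A] : HasZeroObject (FactorCategory X) :=
  (toFactor X).hasZeroObject_of_additive

instance [HasBinaryBiproducts A] : HasBinaryBiproducts (FactorCategory X) where
  has_binary_biproduct P Q :=
    have : PreservesBinaryBiproducts (toFactor X) :=
      preservesBinaryBiproducts_of_preservesBiproducts _
    Functor.hasBinaryBiproduct_of_preserves (toFactor X) P.as Q.as

lemma toFactor_isZero [HasZeroObject A] {T : A} (hT : X T) : IsZero ((toFactor X).obj T) := by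
  rw [IsZero.iff_id_eq_zero, ← (toFactor X).map_id, ← (toFactor X).map_zero]
  exact CategoryTheory.Quotient.sound _ ⟨T, hT, 𝟙 T, 𝟙 T, by simp⟩

end

/-! ### The Verdier quotient `K^b(A)/K^b(X)` and the canonical functor to `K^b(A/[X])` -/

section

variable (X : ObjectProperty A)

/-- The objects of `K^b(A)` which lie in `K^b(X)`: those isomorphic in `K^b(A)` to a bounded
complex in the additive category `X`. -/
def KbSub : ObjectProperty (Kb A) := (mapKb X.ι).essImage

instance : (mapKb X.ι).Full where
  map_surjective f :=
    ⟨ObjectProperty.homMk ((X.ι.mapHomotopyCategory _).preimage f.hom), by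
      ext
      exact (X.ι.mapHomotopyCategory _).map_preimage f.hom⟩

variable [HasZeroObject A] [HasZeroObject X.FullSubcategory]
  [HasBinaryBiproducts X.FullSubcategory]

lemma isZero_mapKb_of_mem {K : Kb A} (hK : KbSub X K) : IsZero ((mapKb (toFactor X)).obj K) := by
  obtain ⟨L, ⟨e⟩⟩ := hK
  refine IsZero.of_iso ?_ ((mapKb (toFactor X)).mapIso e.symm)
  rw [IsZero.iff_id_eq_zero]
  ext
  obtain ⟨⟨M⟩, hM⟩ := L
  have hz : IsZero (((toFactor X).mapHomologicalComplex (ComplexShape.up ℤ)).obj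
      ((X.ι.mapHomologicalComplex (ComplexShape.up ℤ)).obj M)) := by
    rw [IsZero.iff_id_eq_zero]
    ext i
    exact (toFactor_isZero X (M.X i).property).eq_of_src _ _
  exact ((HomotopyCategory.quotient _ _).map_isZero hz).eq_of_src _ _

variable [HasBinaryBiproducts A]

/-- `K^b(X)` is a triangulated subcategory of `K^b(A)`. -/
instance : (KbSub X).IsTriangulated :=
  inferInstanceAs ((mapKb X.ι).essImage.IsTriangulated)

/-- The Verdier quotient `K^b(A)/K^b(X)`: the localization of `K^b(A)` at the morphisms whose
cone lies in `K^b(X)`. -/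
abbrev VerdierQuotient := (KbSub X).trW.Localization

lemma inverts : (KbSub X).trW.IsInvertedBy (mapKb (toFactor X)) := by
  intro K L f hf
  rw [ObjectProperty.trW_iff] at hf
  obtain ⟨Z, g, h, hT, hZ⟩ := hf
  exact (Pretriangulated.Triangle.isZero₃_iff_isIso₁ _
    ((mapKb (toFactor X)).map_distinguished _ hT)).1 (isZero_mapKb_of_mem X hZ)

/-- The canonical functor `Φ : K^b(A)/K^b(X) ⥤ K^b(A/[X])`, sending a complex `Z` in `A` to `Z`
viewed as a complex in `A/[X]`: it is the functor induced on the Verdier quotient by the termwise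
projection `K^b(A) ⥤ K^b(A/[X])`. -/
noncomputable def canonicalFunctor : VerdierQuotient X ⥤ Kb (FactorCategory X) :=
  Localization.Construction.lift (mapKb (toFactor X)) (inverts X)

end

/-! ### `X`-resolutions, `X`-coresolutions and lower extension groups -/

/-- The complex `Hom(T, K)`, with `Hom(T, K^i)` in degree `i`. -/
noncomputable abbrev homFrom (T : A) (K : CochainComplex A ℤ) :
    CochainComplex AddCommGrpCat.{v} ℤ :=
  ((preadditiveCoyoneda.obj (op T)).mapHomologicalComplex (ComplexShape.up ℤ)).obj K

/-- The complex `Hom(K, T)`. The group `Hom(K^i, T)`, which sits in cohomological degree `-i`,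
is indexed here by `i`, and the differential goes from index `i` to index `i - 1`. -/
noncomputable abbrev homTo (K : CochainComplex A ℤ) (T : A) :
    HomologicalComplex AddCommGrpCat.{v} (ComplexShape.up ℤ).symm :=
  ((preadditiveYoneda.obj T).mapHomologicalComplex (ComplexShape.up ℤ).symm).obj
    (HomologicalComplex.op K)

variable (X : ObjectProperty A)

/-- An `X`-resolution of `B`: a complex `⋯ ⟶ X^{-2} ⟶ X^{-1} ⟶ B ⟶ 0` with `B` in degree `0`
and `X^{-i}` in `X` for `i ≥ 1`, such that `Hom(T, -)` makes it acyclic for all `T` in `X`. -/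
structure Resolution (B : A) where
  complex : CochainComplex A ℤ
  isStrictlyLE : complex.IsStrictlyLE 0
  iso : complex.X 0 ≅ B
  mem : ∀ i : ℤ, i < 0 → X (complex.X i)
  acyclic : ∀ T : A, X T → (homFrom T complex).Acyclic

/-- An `X`-coresolution of `B`: a complex `0 ⟶ B ⟶ X^1 ⟶ X^2 ⟶ ⋯` with `B` in degree `0`
and `X^i` in `X` for `i ≥ 1`, such that `Hom(-, T)` makes it acyclic for all `T` in `X`. -/
structure Coresolution (B : A) where
  complex : CochainComplex A ℤ
  isStrictlyGE : complex.IsStrictlyGE 0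
  iso : complex.X 0 ≅ B
  mem : ∀ i : ℤ, 0 < i → X (complex.X i)
  acyclic : ∀ T : A, X T → (homTo complex T).Acyclic

/-- The lower extension group `Ext_{X,n}(P, Q)`, computed either from an `X`-resolution `X_Q` of
the second argument, as `H^{-n} Hom(P, X_Q)`, or from an `X`-coresolution `_PX` of the first, as
`H^{-n} Hom(_PX, Q)`. -/
noncomputable def lowerExt (n : ℤ) {P Q : A} :
    Resolution X Q ⊕ Coresolution X P → AddCommGrpCat.{v}
  | .inl R => (homFrom P R.complex).homology (-n)
  | .inr R => (homTo R.complex Q).homology n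

end LowerExt

/-!
Regard `K^b(A)` as a full subcategory of the unbounded homotopy category `K(A)`. Below, "the
quotient" is the Verdier quotient `K^b(A)/K^b(X)`.

An `X`-resolution `X_Q` of an object `Q` behaves like an injective resolution relative to
`K^b(X)`. It receives no nonzero morphism from `K^b(X)`, since `Hom(T, X_Q)` is acyclic for `T` in
`X` (`hom_eq_zero_of_rightOrthogonal`). It sits in a distinguished triangle `Q ⟶ X_Q ⟶ V ⟶` in
which `V`, the part of `X_Q` in negative degrees, has its terms in `X` and is bounded above; so
every morphism from a bounded complex to `V` factors through a brutal truncation of `V`, which is an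
object of `K^b(X)` (`exists_factorization_right`). A calculation with fractions then compares
`Hom(W, Q)` in the quotient with `Hom(W, X_Q)` in `K(A)`:

* if `Hom(W, Q)` vanishes in the quotient, then `Hom(W, X_Q) = 0` (`eq_zero_of_resolution`);
* if `Hom(W, Q) ⟶ Hom(W, X_Q)` is surjective in `K(A)`, then every morphism `W ⟶ Q` of the
  quotient comes from `K^b(A)` (`localization_map_surjective_of_resolution`).

If `W` is an object `P` placed in degree `-n`, the group `Hom(W, X_Q)` is `H^{-n} Hom(P, X_Q)`,
which is `Ext_{X,n}(P, Q)`. Coresolutions of `P` are treated dually. As every pair of objects is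
compared with the one complex that computes its `Ext` group, it does not matter which of the two
kinds of complex is chosen, nor whether the choices for different pairs are related.

If the canonical functor `Φ` is faithful, then there are no nonzero morphisms in the
quotient between stalk complexes in different degrees, because there are none in `K^b(A/[X])`; hence
`Ext_{X,n}` vanishes for `n ≥ 1`. Conversely, if these groups vanish, then every morphism of the
quotient between stalk complexes comes from `K^b(A)`, and `Φ` is bijective on such morphisms: it is
surjective since `A ⥤ A/[X]` is full, and injective since a morphism of `A` which vanishes in
`A/[X]` factors through an object of `X`, and so vanishes in the quotient
(`canonicalFunctor_map_stalk_bijective`). Stalk complexes generate `K^b` as a triangulated category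
(`prop_of_stalk`), so the five lemma shows that `Φ` is fully faithful. Its essential image is then
triangulated and contains the stalk complexes, hence is everything.
-/

namespace BoundedHomotopy

/-! ### Brutal truncations of complexes -/

section BrutalTruncation

open Pretriangulated

variable {C : Type u} [Category.{v} C] [Preadditive C] [HasZeroObject C]

open Classical in
/-- The term in degree `i` of a complex after the terms in degrees outside `p` are replaced by
zero. -/
noncomputable def cutX (K : CochainComplex C ℤ) (p : ℤ → Prop) (i : ℤ) : C :=
  if p i then K.X i else 0

open Classical in
/-- The inclusion of `cutX K p i` in `K.X i`: an isomorphism if `p i`, and zero otherwise. -/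
noncomputable def cutInc (K : CochainComplex C ℤ) (p : ℤ → Prop) (i : ℤ) : cutX K p i ⟶ K.X i :=
  if h : p i then eqToHom (if_pos h) else 0

open Classical in
/-- The projection of `K.X i` onto `cutX K p i`. -/
noncomputable def cutProj (K : CochainComplex C ℤ) (p : ℤ → Prop) (i : ℤ) : K.X i ⟶ cutX K p i :=
  if h : p i then eqToHom (if_pos h).symm else 0

variable (K : CochainComplex C ℤ) (p : ℤ → Prop)

lemma isZero_cutX {i : ℤ} (h : ¬ p i) : IsZero (cutX K p i) := by
  rw [cutX, if_neg h]
  exact isZero_zero C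

@[simp]
lemma cutInc_cutProj (i : ℤ) : cutInc K p i ≫ cutProj K p i = 𝟙 _ := by
  by_cases h : p i
  · rw [cutInc, cutProj, dif_pos h, dif_pos h]
    exact eqToHom_trans _ _
  · exact (isZero_cutX K p h).eq_of_src _ _

lemma cutProj_cutInc {i : ℤ} (h : p i) : cutProj K p i ≫ cutInc K p i = 𝟙 _ := by
  rw [cutInc, cutProj, dif_pos h, dif_pos h]
  exact eqToHom_trans _ _

lemma cutInc_eq_zero {i : ℤ} (h : ¬ p i) : cutInc K p i = 0 :=
  (isZero_cutX K p h).eq_of_src _ _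

lemma cutProj_eq_zero {i : ℤ} (h : ¬ p i) : cutProj K p i = 0 :=
  (isZero_cutX K p h).eq_of_tgt _ _

/-- The terms of `K` in the degrees which satisfy `p`, with the differentials of `K` between
them. The square of the differential vanishes for every `p`; this is a subcomplex of `K` if `p` is
closed upwards, and a quotient complex if `p` is closed downwards. -/
noncomputable def cut : CochainComplex C ℤ where
  X i := cutX K p i
  d i j := cutInc K p i ≫ K.d i j ≫ cutProj K p j
  shape i j h := by rw [K.shape i j h]; simp
  d_comp_d' i j k _ _ := by
    by_cases h : p j
    · simp only [Category.assoc]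
      rw [← Category.assoc (cutProj K p j), cutProj_cutInc K p h]
      simp
    · simp [cutInc_eq_zero K p h]

/-- The isomorphism between the terms of `cut K p` and `K` in the degrees which are kept. -/
@[simps]
noncomputable def cutXIso {i : ℤ} (h : p i) : (cut K p).X i ≅ K.X i where
  hom := cutInc K p i
  inv := cutProj K p i
  hom_inv_id := cutInc_cutProj K p i
  inv_hom_id := cutProj_cutInc K p h

lemma isZero_cut_X {i : ℤ} (h : ¬ p i) : IsZero ((cut K p).X i) := isZero_cutX K p h

lemma cut_isStrictlyGE (a : ℤ) (h : ∀ i, p i → a ≤ i) : (cut K p).IsStrictlyGE a := by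
  rw [CochainComplex.isStrictlyGE_iff]
  exact fun i hi => isZero_cut_X K p fun hp => by have := h i hp; lia

lemma cut_isStrictlyLE (b : ℤ) (h : ∀ i, p i → i ≤ b) : (cut K p).IsStrictlyLE b := by
  rw [CochainComplex.isStrictlyLE_iff]
  exact fun i hi => isZero_cut_X K p fun hp => by have := h i hp; lia

instance cut_isStrictlyGE_of_isStrictlyGE (a : ℤ) [K.IsStrictlyGE a] :
    (cut K p).IsStrictlyGE a := by
  rw [CochainComplex.isStrictlyGE_iff]
  intro i hi
  rw [IsZero.iff_id_eq_zero]
  change 𝟙 (cutX K p i) = 0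
  rw [← cutInc_cutProj, (K.isZero_of_isStrictlyGE a i).eq_of_tgt (cutInc K p i) 0, zero_comp]

instance cut_isStrictlyLE_of_isStrictlyLE (b : ℤ) [K.IsStrictlyLE b] :
    (cut K p).IsStrictlyLE b := by
  rw [CochainComplex.isStrictlyLE_iff]
  intro i hi
  rw [IsZero.iff_id_eq_zero]
  change 𝟙 (cutX K p i) = 0
  rw [← cutInc_cutProj, (K.isZero_of_isStrictlyLE b i).eq_of_tgt (cutInc K p i) 0, zero_comp]

/-- The inclusion of the brutal truncation in degrees `≥ a`. -/
noncomputable def cutι (a : ℤ) : cut K (a ≤ ·) ⟶ K where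
  f i := cutInc K (a ≤ ·) i
  comm' i j hij := by
    obtain rfl : i + 1 = j := hij
    by_cases h : a ≤ i
    · dsimp [cut]
      rw [Category.assoc, Category.assoc, cutProj_cutInc K _ (by lia : a ≤ i + 1),
        Category.comp_id]
    · exact (isZero_cutX K _ h).eq_of_src _ _

/-- The projection onto the brutal truncation in degrees `< a`. -/
noncomputable def cutπ (a : ℤ) : K ⟶ cut K (fun i => ¬ a ≤ i) where
  f i := cutProj K (fun i => ¬ a ≤ i) i
  comm' i j hij := by
    obtain rfl : i + 1 = j := hij
    by_cases h : a ≤ i + 1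
    · exact (isZero_cutX K (fun i => ¬ a ≤ i) (not_not.2 h)).eq_of_tgt _ _
    · dsimp [cut]
      rw [← Category.assoc (cutProj _ _ _), cutProj_cutInc K _ (by lia : ¬ a ≤ i),
        Category.id_comp]

/-- The short complex `σ^{≥ a} K ⟶ K ⟶ σ^{< a} K`. -/
@[simps]
noncomputable def cutShortComplex (a : ℤ) : ShortComplex (CochainComplex C ℤ) where
  X₁ := cut K (a ≤ ·)
  X₂ := K
  X₃ := cut K (fun i => ¬ a ≤ i)
  f := cutι K a
  g := cutπ K a
  zero := by
    ext i
    by_cases h : a ≤ i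
    · exact (isZero_cutX K (fun i => ¬ a ≤ i) (not_not.2 h)).eq_of_tgt _ _
    · exact (isZero_cutX K _ h).eq_of_src _ _

/-- The short complex `σ^{≥ a} K ⟶ K ⟶ σ^{< a} K` is split in each degree. -/
noncomputable def cutSplitting (a n : ℤ) :
    ((cutShortComplex K a).map (HomologicalComplex.eval C _ n)).Splitting where
  r := cutProj K (a ≤ ·) n
  s := cutInc K (fun i => ¬ a ≤ i) n
  f_r := cutInc_cutProj K (a ≤ ·) n
  s_g := cutInc_cutProj K (fun i => ¬ a ≤ i) n
  id := by
    change cutProj K (a ≤ ·) n ≫ cutInc K (a ≤ ·) n +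
      cutProj K (fun i => ¬ a ≤ i) n ≫ cutInc K (fun i => ¬ a ≤ i) n = 𝟙 (K.X n)
    by_cases h : a ≤ n
    · rw [cutProj_cutInc K (a ≤ ·) h, cutProj_eq_zero K (fun i => ¬ a ≤ i) (not_not.2 h),
        zero_comp, add_zero]
    · rw [cutProj_eq_zero K (a ≤ ·) h, cutProj_cutInc K (fun i => ¬ a ≤ i) h, zero_comp,
        zero_add]

/-- The distinguished triangle `σ^{≥ a} K ⟶ K ⟶ σ^{< a} K ⟶` in the homotopy category. -/
noncomputable abbrev cutTriangle (a : ℤ) :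
    Triangle (HomotopyCategory C (ComplexShape.up ℤ)) :=
  CochainComplex.trianglehOfDegreewiseSplit (cutShortComplex K a) (cutSplitting K a)

lemma cutTriangle_distinguished [HasBinaryBiproducts C] (a : ℤ) :
    cutTriangle K a ∈ distTriang _ :=
  (HomotopyCategory.distinguished_iff_iso_trianglehOfDegreewiseSplit _).2
    ⟨_, cutSplitting K a, ⟨Iso.refl _⟩⟩

end BrutalTruncation

/-! ### Stalk complexes and dévissage in `K^b(C)` -/

section Devissage

open Pretriangulated

variable {C : Type u} [Category.{v} C] [Preadditive C]

/-- A bounded complex, as an object of `K^b(C)`. -/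
def kbOf (K : CochainComplex C ℤ) (hK : ∃ a b : ℤ, K.IsStrictlyGE a ∧ K.IsStrictlyLE b) : Kb C :=
  ⟨(HomotopyCategory.quotient C (ComplexShape.up ℤ)).obj K, hK⟩

variable [HasZeroObject C]

variable (C) in
/-- The functor which sends an object `P` of `C` to the complex `P` in degree `n`. -/
noncomputable def stalk (n : ℤ) : C ⥤ Kb C :=
  (bounded C).lift (HomotopyCategory.singleFunctor C n) (fun P =>
    ⟨n, n, inferInstanceAs (CochainComplex.IsStrictlyGE
        ((HomologicalComplex.single C (.up ℤ) n).obj P) n),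
      inferInstanceAs (CochainComplex.IsStrictlyLE
        ((HomologicalComplex.single C (.up ℤ) n).obj P) n)⟩)

instance (n : ℤ) : (stalk C n).Additive where
  map_add {_ _ f g} := by
    ext
    exact (HomotopyCategory.singleFunctor C n).map_add

/-- Shifting by `n` moves a stalk complex from degree `n + a` to degree `a`. -/
noncomputable def stalkShiftIso (n a a' : ℤ) (h : n + a = a') (P : C) :
    ((stalk C a').obj P)⟦n⟧ ≅ (stalk C a).obj P :=
  (bounded C).isoMk (((bounded C).ι.commShiftIso n).app _ ≪≫
    ((HomotopyCategory.singleFunctors C).shiftIso n a a' h).app P)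

/-- A bounded complex concentrated in one degree is a stalk complex. -/
lemma exists_iso_stalk (K : CochainComplex C ℤ) (n : ℤ)
    (hK : ∃ a b : ℤ, K.IsStrictlyGE a ∧ K.IsStrictlyLE b)
    (h₁ : K.IsStrictlyGE n) (h₂ : K.IsStrictlyLE n) :
    Nonempty (kbOf K hK ≅ (stalk C n).obj (K.X n)) := by
  obtain ⟨M, ⟨e⟩⟩ := K.exists_iso_single n
  have e' : K.X n ≅ M := (HomologicalComplex.eval C _ n).mapIso e ≪≫
    HomologicalComplex.singleObjXSelf (ComplexShape.up ℤ) n M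
  exact ⟨(bounded C).isoMk ((HomotopyCategory.quotient C _).mapIso e ≪≫
    (HomotopyCategory.singleFunctor C n).mapIso e'.symm)⟩

variable [HasBinaryBiproducts C]

/-- Dévissage: a bounded complex belongs to a triangulated subcategory of the homotopy category as
soon as its terms, placed in their degrees, do. -/
lemma prop_quotient_obj_of_single
    (S : ObjectProperty (HomotopyCategory C (ComplexShape.up ℤ))) [S.IsTriangulated]
    [S.IsClosedUnderIsomorphisms] (K : CochainComplex C ℤ) (a b : ℤ)
    (ha : K.IsStrictlyGE a) (hb : K.IsStrictlyLE b)
    (h : ∀ i, S ((HomotopyCategory.singleFunctor C i).obj (K.X i))) :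
    S ((HomotopyCategory.quotient C _).obj K) := by
  obtain ⟨n, hn⟩ : ∃ n : ℕ, b < a + n := ⟨(b - a + 1).toNat, by lia⟩
  replace hb : K.IsStrictlyLE (a + n - 1) := K.isStrictlyLE_of_le b _ (by lia)
  clear hn
  induction n generalizing K a with
  | zero =>
    refine S.prop_of_isZero ((HomotopyCategory.quotient C _).map_isZero ?_)
    rw [IsZero.iff_id_eq_zero]
    ext i
    by_cases hi : i < a
    · exact (K.isZero_of_isStrictlyGE a i hi).eq_of_src _ _
    · exact (K.isZero_of_isStrictlyLE (a + (0 : ℕ) - 1) i (by simp; lia)).eq_of_src _ _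
  | succ n ih =>
    have hcut : ∀ p : ℤ → Prop, ∀ i,
        S ((HomotopyCategory.singleFunctor C i).obj ((cut K p).X i)) := fun p i => by
      by_cases hp : p i
      · exact S.prop_of_iso ((HomotopyCategory.singleFunctor C i).mapIso (cutXIso K p hp).symm)
          (h i)
      · exact S.prop_of_isZero
          ((HomotopyCategory.singleFunctor C i).map_isZero (isZero_cut_X K p hp))
    have hGE₁ : (cut K (a + 1 ≤ ·)).IsStrictlyGE (a + 1) := cut_isStrictlyGE _ _ _ fun _ h => h
    have hLE₁ : (cut K (a + 1 ≤ ·)).IsStrictlyLE (a + 1 + n - 1) := by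
      have := cut_isStrictlyLE_of_isStrictlyLE K (a + 1 ≤ ·) (a + (n + 1 : ℕ) - 1)
      exact CochainComplex.isStrictlyLE_of_le _ (a + (n + 1 : ℕ) - 1) _ (by push_cast; lia)
    have hLE₃ : (cut K (fun i => ¬ a + 1 ≤ i)).IsStrictlyLE a :=
      cut_isStrictlyLE _ _ _ fun i h => by lia
    refine S.ext_of_isTriangulatedClosed₂ _ (cutTriangle_distinguished K (a + 1))
      (ih (cut K (a + 1 ≤ ·)) (a + 1) hGE₁ (hcut _) hLE₁) ?_
    obtain ⟨e⟩ := exists_iso_stalk (cut K (fun i => ¬ a + 1 ≤ i)) a ⟨a, a, inferInstance, hLE₃⟩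
      inferInstance hLE₃
    exact S.prop_of_iso ((bounded C).ι.mapIso e.symm) (hcut _ _)

/-- Dévissage in `K^b(C)`. -/
lemma prop_kbOf_of_stalk (S : ObjectProperty (Kb C)) [S.IsTriangulated]
    [S.IsClosedUnderIsomorphisms] (K : CochainComplex C ℤ)
    (hK : ∃ a b : ℤ, K.IsStrictlyGE a ∧ K.IsStrictlyLE b)
    (h : ∀ i, S ((stalk C i).obj (K.X i))) : S (kbOf K hK) := by
  obtain ⟨a, b, ha, hb⟩ := id hK
  obtain ⟨Z, hZ, ⟨e⟩⟩ := prop_quotient_obj_of_single (S.map (bounded C).ι) K a b ha hb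
    (fun i => S.prop_map_obj (bounded C).ι (h i))
  exact S.prop_of_iso ((bounded C).isoMk e) hZ

/-- A triangulated subcategory of `K^b(C)` which contains the stalk complexes is everything. -/
lemma prop_of_stalk (S : ObjectProperty (Kb C)) [S.IsTriangulated]
    [S.IsClosedUnderIsomorphisms] (h : ∀ (P : C) (i : ℤ), S ((stalk C i).obj P)) (K : Kb C) :
    S K := by
  obtain ⟨⟨K⟩, hK⟩ := K
  exact prop_kbOf_of_stalk S K hK fun i => h _ i

end Devissage

/-! ### Morphisms from and to stalk complexes -/

section StalkHom

open CochainComplex.HomComplex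

variable {C : Type u} [Category.{v} C] [Preadditive C]

/-- There are no nonzero morphisms between complexes which are concentrated in disjoint sets of
degrees. -/
lemma quotient_hom_eq_zero_of_disjoint {K L : CochainComplex C ℤ}
    (h : ∀ i, IsZero (K.X i) ∨ IsZero (L.X i))
    (f : (HomotopyCategory.quotient C (ComplexShape.up ℤ)).obj K ⟶
      (HomotopyCategory.quotient C (ComplexShape.up ℤ)).obj L) : f = 0 := by
  obtain ⟨φ, rfl⟩ := (HomotopyCategory.quotient C _).map_surjective f
  obtain rfl : φ = 0 := by
    ext i
    obtain h | h := h i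
    · exact h.eq_of_src _ _
    · exact h.eq_of_tgt _ _
  exact Functor.map_zero _ _ _

lemma quotient_hom_eq_zero_of_lt {K L : CochainComplex C ℤ} (a b : ℤ) (hab : b < a)
    [hK : K.IsStrictlyGE a] [hL : L.IsStrictlyLE b]
    (f : (HomotopyCategory.quotient C (ComplexShape.up ℤ)).obj K ⟶
      (HomotopyCategory.quotient C (ComplexShape.up ℤ)).obj L) : f = 0 :=
  quotient_hom_eq_zero_of_disjoint (fun i => by
    by_cases hi : i < a
    · exact Or.inl (K.isZero_of_isStrictlyGE a i hi)
    · exact Or.inr (L.isZero_of_isStrictlyLE b i (by lia))) f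

lemma quotient_map_eq_zero_iff_mem_coboundaries {K L : CochainComplex C ℤ} (φ : K ⟶ L) :
    (HomotopyCategory.quotient C _).map φ = 0 ↔ Cocycle.ofHom φ ∈ coboundaries K L 0 := by
  rw [HomotopyCategory.quotient_map_eq_zero_iff, mem_coboundaries_iff _ (-1) (by simp),
    (Cochain.equivHomotopy φ 0).nonempty_congr]
  constructor
  · rintro ⟨z, hz⟩
    exact ⟨z, by simpa using hz.symm⟩
  · rintro ⟨z, hz⟩
    exact ⟨z, by simpa using hz.symm⟩

lemma forall_quotient_hom_eq_zero_iff {K L : CochainComplex C ℤ} :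
    (∀ f : (HomotopyCategory.quotient C (ComplexShape.up ℤ)).obj K ⟶
      (HomotopyCategory.quotient C (ComplexShape.up ℤ)).obj L, f = 0) ↔
      ∀ z : Cocycle K L 0, z ∈ coboundaries K L 0 := by
  constructor
  · intro h z
    obtain ⟨φ, rfl⟩ := (Cocycle.equivHom K L).surjective z
    exact (quotient_map_eq_zero_iff_mem_coboundaries φ).1 (h _)
  · intro h f
    obtain ⟨φ, rfl⟩ := (HomotopyCategory.quotient C _).map_surjective f
    exact (quotient_map_eq_zero_iff_mem_coboundaries φ).2 (h _)

variable [HasZeroObject C]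

/-- `Hom(P[-n], K) = 0` in the homotopy category means that `Hom(P, K)` is exact in degree `n`. -/
lemma single_hom_eq_zero_iff (P : C) (n : ℤ) (K : CochainComplex C ℤ) :
    (∀ f : (HomotopyCategory.singleFunctor C n).obj P ⟶
      (HomotopyCategory.quotient C (ComplexShape.up ℤ)).obj K, f = 0) ↔
      ∀ f : P ⟶ K.X n, f ≫ K.d n (n + 1) = 0 → ∃ g : P ⟶ K.X (n - 1), g ≫ K.d (n - 1) n = f := by
  refine (forall_quotient_hom_eq_zero_iff
    (K := (CochainComplex.singleFunctor C n).obj P)).trans ⟨fun h f hf => ?_, fun h z => ?_⟩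
  · exact (Cocycle.fromSingleMk_mem_coboundaries_iff f (add_zero n) (n + 1) rfl hf (n - 1)
      (by lia)).1 (h _)
  · obtain ⟨f, hf, rfl⟩ := Cocycle.fromSingleMk_surjective z n (add_zero n) (n + 1) rfl
    exact (Cocycle.fromSingleMk_mem_coboundaries_iff f (add_zero n) (n + 1) rfl hf (n - 1)
      (by lia)).2 (h f hf)

/-- `Hom(K, P[-n]) = 0` in the homotopy category means that `Hom(K, P)` is exact in degree `n`. -/
lemma hom_single_eq_zero_iff (P : C) (n : ℤ) (K : CochainComplex C ℤ) :
    (∀ f : (HomotopyCategory.quotient C (ComplexShape.up ℤ)).obj K ⟶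
      (HomotopyCategory.singleFunctor C n).obj P, f = 0) ↔
      ∀ f : K.X n ⟶ P, K.d (n - 1) n ≫ f = 0 → ∃ g : K.X (n + 1) ⟶ P, K.d n (n + 1) ≫ g = f := by
  refine (forall_quotient_hom_eq_zero_iff
    (L := (CochainComplex.singleFunctor C n).obj P)).trans ⟨fun h f hf => ?_, fun h z => ?_⟩
  · exact (Cocycle.toSingleMk_mem_coboundaries_iff f (add_zero n) (n - 1) (by lia) hf (n + 1)
      rfl).1 (h _)
  · obtain ⟨f, hf, rfl⟩ := Cocycle.toSingleMk_surjective z n (add_zero n) (n - 1) (by lia)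
    exact (Cocycle.toSingleMk_mem_coboundaries_iff f (add_zero n) (n - 1) (by lia) hf (n + 1)
      rfl).2 (h f hf)

lemma stalk_hom_eq_zero {m n : ℤ} (hmn : m ≠ n) {P Q : C}
    (f : (stalk C m).obj P ⟶ (stalk C n).obj Q) : f = 0 := by
  ext
  refine quotient_hom_eq_zero_of_disjoint (fun i => ?_) f.hom
  by_cases hi : i = m
  · exact Or.inr (HomologicalComplex.isZero_single_obj_X _ _ _ _ (by lia))
  · exact Or.inl (HomologicalComplex.isZero_single_obj_X _ _ _ _ hi)

instance (n : ℤ) : (stalk C n).Full where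
  map_surjective f := by
    obtain ⟨φ, hφ⟩ := (HomotopyCategory.quotient C _).map_surjective f.hom
    obtain ⟨g, rfl⟩ := (CochainComplex.singleFunctor C n).map_surjective φ
    exact ⟨g, by ext; exact hφ⟩

instance (n : ℤ) : (stalk C n).Faithful where
  map_injective {P Q f g} hfg := by
    have h := congrArg InducedCategory.Hom.hom hfg
    have h := HomotopyCategory.homotopyOfEq ((CochainComplex.singleFunctor C n).map f)
      ((CochainComplex.singleFunctor C n).map g) h
    refine (CochainComplex.singleFunctor C n).map_injective ?_
    ext i
    rw [h.comm i]
    simp [dNext, prevD]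

variable {D : Type u'} [Category.{v'} D] [Preadditive D] [HasZeroObject D] (F : C ⥤ D)
  [F.Additive]

instance : (mapKb F).Additive where
  map_add {_ _ f g} := by
    ext
    exact (F.mapHomotopyCategory _).map_add (f := f.hom) (g := g.hom)

/-- Additive functors commute with the formation of stalk complexes. -/
noncomputable def stalkMapKbIso (n : ℤ) : stalk C n ⋙ mapKb F ≅ F ⋙ stalk D n :=
  NatIso.ofComponents (fun P => (bounded D).isoMk
    ((HomotopyCategory.quotient D _).mapIso
      ((HomologicalComplex.singleMapHomologicalComplex F (ComplexShape.up ℤ) n).app P)))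
    (fun {P Q} f => by
      ext
      have h := (HomologicalComplex.singleMapHomologicalComplex F
        (ComplexShape.up ℤ) n).hom.naturality f
      replace h := congrArg (HomotopyCategory.quotient D _).map h
      rw [Functor.map_comp, Functor.map_comp] at h
      exact h)

/-- Every morphism between the images of two stalk complexes comes from a morphism between them
if the functor is full. -/
lemma mapKb_map_stalk_surjective [F.Full] (m n : ℤ) (P Q : C)
    (g : (mapKb F).obj ((stalk C m).obj P) ⟶ (mapKb F).obj ((stalk C n).obj Q)) :
    ∃ f, (mapKb F).map f = g := by
  obtain ⟨f, hf⟩ : ∃ f, f = ((stalkMapKbIso F m).app P).inv ≫ g ≫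
      ((stalkMapKbIso F n).app Q).hom := ⟨_, rfl⟩
  have hg : g = ((stalkMapKbIso F m).app P).hom ≫ f ≫ ((stalkMapKbIso F n).app Q).inv := by
    simp [hf]
  by_cases hmn : m = n
  · subst hmn
    obtain ⟨f, rfl⟩ := (F ⋙ stalk D m).map_surjective f
    refine ⟨(stalk C m).map f, ?_⟩
    rw [hg, Iso.app_hom, Iso.app_inv, ← NatTrans.naturality_assoc]
    simp
  · refine ⟨0, ?_⟩
    rw [hg, stalk_hom_eq_zero hmn f]
    simp

/-- A morphism of stalk complexes in the same degree which is killed by `F` comes from a morphism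
killed by `F`. -/
lemma exists_of_mapKb_map_stalk_eq_zero {n : ℤ} {P Q : C}
    (f : (stalk C n).obj P ⟶ (stalk C n).obj Q) (hf : (mapKb F).map f = 0) :
    ∃ f₀ : P ⟶ Q, (stalk C n).map f₀ = f ∧ F.map f₀ = 0 := by
  obtain ⟨f₀, rfl⟩ := (stalk C n).map_surjective f
  refine ⟨f₀, rfl, (stalk D n).map_injective ?_⟩
  have h := (stalkMapKbIso F n).hom.naturality f₀
  rw [Functor.comp_map, hf, zero_comp] at h
  rw [Functor.map_zero, ← cancel_epi ((stalkMapKbIso F n).hom.app P), comp_zero]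
  exact h.symm

end StalkHom

/-! ### Exact sequences of a distinguished triangle -/

section Exactness

open Pretriangulated

variable {C : Type*} [Category* C] [Preadditive C] [HasZeroObject C] [HasShift C ℤ]
  [∀ n : ℤ, (shiftFunctor C n).Additive] [Pretriangulated C]
  {P Q R : C} {f : P ⟶ Q} {g : Q ⟶ R} {h : R ⟶ P⟦(1 : ℤ)⟧}

lemma comp_eq_zero_of_distTriang (hT : Triangle.mk f g h ∈ distTriang C) : f ≫ g = 0 :=
  comp_distTriang_mor_zero₁₂ _ hT

lemma exists_lift_of_distTriang (hT : Triangle.mk f g h ∈ distTriang C) {W : C} (k : W ⟶ Q)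
    (hk : k ≫ g = 0) : ∃ l : W ⟶ P, k = l ≫ f :=
  Triangle.coyoneda_exact₂ _ hT k hk

lemma exists_desc_of_distTriang (hT : Triangle.mk f g h ∈ distTriang C) {W : C} (k : Q ⟶ W)
    (hk : f ≫ k = 0) : ∃ l : R ⟶ W, k = g ≫ l :=
  Triangle.yoneda_exact₂ _ hT k hk

lemma exists_distTriang_rotate (hT : Triangle.mk f g h ∈ distTriang C) :
    ∃ h' : P⟦(1 : ℤ)⟧ ⟶ Q⟦(1 : ℤ)⟧, Triangle.mk g h h' ∈ distTriang C :=
  ⟨_, rot_of_distTriang _ hT⟩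

lemma exists_distTriang_invRotate (hT : Triangle.mk f g h ∈ distTriang C) :
    ∃ (f' : R⟦(-1 : ℤ)⟧ ⟶ P) (h' : Q ⟶ R⟦(-1 : ℤ)⟧⟦(1 : ℤ)⟧),
      Triangle.mk f' f h' ∈ distTriang C :=
  ⟨_, _, inv_rot_of_distTriang _ hT⟩

lemma exists_distTriang_of_iso₁ (hT : Triangle.mk f g h ∈ distTriang C) {P' : C} (e : P ≅ P') :
    ∃ h' : R ⟶ P'⟦(1 : ℤ)⟧, Triangle.mk (e.inv ≫ f) g h' ∈ distTriang C :=
  ⟨h ≫ e.hom⟦(1 : ℤ)⟧', isomorphic_distinguished _ hT _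
    (Triangle.isoMk _ _ e.symm (Iso.refl _) (Iso.refl _)
      (by change (e.inv ≫ f) ≫ 𝟙 Q = e.inv ≫ f; simp)
      (by change g ≫ 𝟙 R = 𝟙 Q ≫ g; simp)
      (by change (h ≫ e.hom⟦(1 : ℤ)⟧') ≫ e.inv⟦(1 : ℤ)⟧' = 𝟙 R ≫ h; simp [← Functor.map_comp]))⟩

lemma exists_distTriang_of_iso₃ (hT : Triangle.mk f g h ∈ distTriang C) {R' : C} (e : R ≅ R') :
    ∃ h' : R' ⟶ P⟦(1 : ℤ)⟧, Triangle.mk f (g ≫ e.hom) h' ∈ distTriang C :=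
  ⟨e.inv ≫ h, isomorphic_distinguished _ hT _
    (Triangle.isoMk _ _ (Iso.refl _) (Iso.refl _) e.symm
      (by change f ≫ 𝟙 Q = 𝟙 P ≫ f; simp)
      (by change (g ≫ e.hom) ≫ e.inv = 𝟙 Q ≫ g; simp)
      (by change (e.inv ≫ h) ≫ (𝟙 P)⟦(1 : ℤ)⟧' = e.inv ≫ h; simp))⟩

variable {D : Type*} [Category* D] [Preadditive D] [HasZeroObject D] [HasShift D ℤ]
  [∀ n : ℤ, (shiftFunctor D n).Additive] [Pretriangulated D]
  (G : C ⥤ D) [G.CommShift ℤ] [G.IsTriangulated]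

lemma exists_distTriang_map (hT : Triangle.mk f g h ∈ distTriang C) :
    ∃ h' : G.obj R ⟶ (G.obj P)⟦(1 : ℤ)⟧, Triangle.mk (G.map f) (G.map g) h' ∈ distTriang D :=
  ⟨_, G.map_distinguished _ hT⟩

end Exactness

/-! ### Morphisms in a Verdier quotient -/

section VerdierHom

open Pretriangulated

variable {B : Type*} [Category* B] [Preadditive B] [HasZeroObject B] [HasShift B ℤ]
  [∀ n : ℤ, (shiftFunctor B n).Additive] [Pretriangulated B] (S : ObjectProperty B)
  {D : Type*} [Category* D] [Preadditive D] (L : B ⥤ D) [L.IsLocalization S.trW] [L.Additive]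

include S in
lemma isZero_localization_obj {Z : B} (hZ : S Z) : IsZero (L.obj Z) := by
  have h : S.trW (0 : 0 ⟶ Z) := ObjectProperty.trW.mk S (contractible_distinguished₁ Z) hZ
  have := Localization.inverts L S.trW _ h
  exact (L.map_isZero (isZero_zero B)).of_iso (asIso (L.map (0 : 0 ⟶ Z))).symm

variable [IsTriangulated B] [S.IsTriangulated]

/-- The morphisms which vanish in the Verdier quotient by `S` are those which factor through an
object of `S`. -/
lemma localization_map_eq_zero_iff {P Q : B} (f : P ⟶ Q) :
    L.map f = 0 ↔ ∃ (Z : B) (_ : S Z) (a : P ⟶ Z) (b : Z ⟶ Q), f = a ≫ b := by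
  constructor
  · intro hf
    rw [← L.map_zero, MorphismProperty.map_eq_iff_postcomp L S.trW] at hf
    obtain ⟨Q', s, hs, hf⟩ := hf
    obtain ⟨Z, b, c, hT, hZ⟩ := (S.trW_iff' s).1 hs
    obtain ⟨a, ha⟩ := exists_lift_of_distTriang hT f (by simpa using hf)
    exact ⟨Z, hZ, a, b, ha⟩
  · rintro ⟨Z, hZ, a, b, rfl⟩
    rw [L.map_comp, (isZero_localization_obj S L hZ).eq_of_tgt (L.map a) 0, zero_comp]

variable {T : Type*} [Category* T] [Preadditive T] [HasZeroObject T] [HasShift T ℤ]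
  [∀ n : ℤ, (shiftFunctor T n).Additive] [Pretriangulated T]
  (J : B ⥤ T) [J.Full]

section Resolution

variable {Q : B} {R V : T} {i : J.obj Q ⟶ R} {p : R ⟶ V} {d : V ⟶ (J.obj Q)⟦(1 : ℤ)⟧}

include S in
/-- A morphism `f : W ⟶ Q` which is killed by `Q ⟶ R` factors through `V⟦-1⟧`, hence through `S`. -/
lemma localization_map_eq_zero_of_comp_eq_zero [J.Faithful]
    (hT : Triangle.mk i p d ∈ distTriang T)
    (hV : ∀ (W : B) (g : J.obj W ⟶ V⟦(-1 : ℤ)⟧),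
      ∃ (Z : B) (_ : S Z) (a : W ⟶ Z) (b : J.obj Z ⟶ V⟦(-1 : ℤ)⟧), g = J.map a ≫ b)
    {W : B} (f : W ⟶ Q) (hf : J.map f ≫ i = 0) : L.map f = 0 := by
  obtain ⟨i', _, hT'⟩ := exists_distTriang_invRotate hT
  obtain ⟨g, hg⟩ := exists_lift_of_distTriang hT' (J.map f) hf
  obtain ⟨Z, hZ, a, b, rfl⟩ := hV W g
  refine (localization_map_eq_zero_iff S L f).2 ⟨Z, hZ, a,
    J.preimage (b ≫ i'), J.map_injective ?_⟩
  simpa using hg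

variable [J.CommShift ℤ] [J.IsTriangulated]

/-- Let `Q ⟶ R ⟶ V ⟶` be a distinguished triangle, where `R` receives no nonzero morphism from `S`
and every morphism to `V⟦-1⟧` factors through `S`. Then `R` plays the role of an injective
resolution of `Q`: if every morphism `W ⟶ R` comes from a morphism `W ⟶ Q`, then so does every
morphism `W ⟶ Q` of the Verdier quotient. -/
lemma localization_map_surjective_of_resolution [J.Faithful]
    (hT : Triangle.mk i p d ∈ distTriang T)
    (hR : ∀ (Z : B), S Z → ∀ g : J.obj Z ⟶ R, g = 0)
    (hV : ∀ (W : B) (g : J.obj W ⟶ V⟦(-1 : ℤ)⟧),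
      ∃ (Z : B) (_ : S Z) (a : W ⟶ Z) (b : J.obj Z ⟶ V⟦(-1 : ℤ)⟧), g = J.map a ≫ b)
    {W : B} (hW : ∀ k : J.obj W ⟶ R, ∃ f : W ⟶ Q, k = J.map f ≫ i) :
    Function.Surjective (L.map : (W ⟶ Q) → _) := by
  intro φ
  obtain ⟨ψ, hψ⟩ := Localization.exists_rightFraction L S.trW φ
  -- If `φ` is the fraction `ψ.f ∘ ψ.s⁻¹`, the morphism `ψ.f ≫ i` extends along `ψ.s`, whose cone is
  -- in `S`.
  obtain ⟨Z, z, c, hZT, hZ⟩ := (S.trW_iff' ψ.s).1 ψ.hs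
  obtain ⟨_, hZT'⟩ := exists_distTriang_map J hZT
  obtain ⟨k, hk⟩ := exists_desc_of_distTriang hZT' (J.map ψ.f ≫ i) (hR Z hZ _)
  obtain ⟨f, rfl⟩ := hW k
  have h : L.map (ψ.f - ψ.s ≫ f) = 0 := by
    refine localization_map_eq_zero_of_comp_eq_zero S L J hT hV _ ?_
    rw [J.map_sub, Preadditive.sub_comp, sub_eq_zero, hk]
    simp
  have := Localization.inverts L S.trW ψ.s ψ.hs
  refine ⟨f, ?_⟩
  rw [hψ, ← cancel_epi (L.map ψ.s), MorphismProperty.RightFraction.map_s_comp_map,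
    ← L.map_comp, ← sub_eq_zero, ← L.map_sub, ← neg_sub, L.map_neg, h, neg_zero]

/-- In the situation of `localization_map_surjective_of_resolution`, the morphisms `W ⟶ R` embed
in the morphisms `W ⟶ Q` of the Verdier quotient. -/
lemma eq_zero_of_resolution (hT : Triangle.mk i p d ∈ distTriang T)
    (hR : ∀ (Z : B), S Z → ∀ g : J.obj Z ⟶ R, g = 0)
    (hV : ∀ (W : B) (g : J.obj W ⟶ V),
      ∃ (Z : B) (_ : S Z) (a : W ⟶ Z) (b : J.obj Z ⟶ V), g = J.map a ≫ b)
    {W : B} (hW : ∀ φ : L.obj W ⟶ L.obj Q, φ = 0) (k : J.obj W ⟶ R) : k = 0 := by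
  -- As `k ≫ p` factors through an object of `S`, the restriction of `k` along some `t` with cone in
  -- `S` lifts to `Q`. The lift vanishes in the quotient, so it factors through `S` and dies in `R`;
  -- hence `k` factors through the cone of `t`.
  obtain ⟨Z, hZ, a, b, hab⟩ := hV W (k ≫ p)
  obtain ⟨W', t, c, hWT⟩ := distinguished_cocone_triangle₁ a
  have hta : t ≫ a = 0 := comp_eq_zero_of_distTriang hWT
  obtain ⟨_, hWT'⟩ := exists_distTriang_map J hWT
  obtain ⟨f, hf⟩ := exists_lift_of_distTriang hT (J.map t ≫ k) (by
    rw [Category.assoc, hab, ← J.map_comp_assoc, hta, J.map_zero, zero_comp])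
  obtain ⟨f, rfl⟩ := J.map_surjective f
  have ht : S.trW t := ObjectProperty.trW.mk S hWT hZ
  have := Localization.inverts L S.trW t ht
  have hLf : L.map f = 0 := by
    rw [← cancel_epi (inv (L.map t)), comp_zero]
    exact hW _
  obtain ⟨Z', hZ', a', b', rfl⟩ := (localization_map_eq_zero_iff S L f).1 hLf
  obtain ⟨k', rfl⟩ := exists_desc_of_distTriang hWT' k (by
    rw [hf, J.map_comp, Category.assoc, hR Z' hZ' (J.map b' ≫ i), comp_zero])
  rw [hR Z hZ k', comp_zero]

end Resolution

section Coresolution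

variable {P : B} {R U : T} {j : U ⟶ R} {p : R ⟶ J.obj P} {d : J.obj P ⟶ U⟦(1 : ℤ)⟧}

include S in
/-- A morphism `f : P ⟶ W` which is killed by `R ⟶ P` factors through `U⟦1⟧`, hence through `S`. -/
lemma localization_map_eq_zero_of_comp_eq_zero' [J.Faithful]
    (hT : Triangle.mk j p d ∈ distTriang T)
    (hU : ∀ (W : B) (g : U⟦(1 : ℤ)⟧ ⟶ J.obj W),
      ∃ (Z : B) (_ : S Z) (b : U⟦(1 : ℤ)⟧ ⟶ J.obj Z) (a : Z ⟶ W), g = b ≫ J.map a)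
    {W : B} (f : P ⟶ W) (hf : p ≫ J.map f = 0) : L.map f = 0 := by
  obtain ⟨_, hT'⟩ := exists_distTriang_rotate hT
  obtain ⟨g, hg⟩ := exists_desc_of_distTriang hT' (J.map f) hf
  obtain ⟨Z, hZ, b, a, rfl⟩ := hU W g
  refine (localization_map_eq_zero_iff S L f).2 ⟨Z, hZ, J.preimage (d ≫ b), a,
    J.map_injective ?_⟩
  simpa using hg

variable [J.CommShift ℤ] [J.IsTriangulated]

/-- The dual of `localization_map_surjective_of_resolution`: `R` plays the role of a projective
resolution of `P`. -/
lemma localization_map_surjective_of_coresolution [J.Faithful]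
    (hT : Triangle.mk j p d ∈ distTriang T)
    (hR : ∀ (Z : B), S Z → ∀ g : R ⟶ J.obj Z, g = 0)
    (hU : ∀ (W : B) (g : U⟦(1 : ℤ)⟧ ⟶ J.obj W),
      ∃ (Z : B) (_ : S Z) (b : U⟦(1 : ℤ)⟧ ⟶ J.obj Z) (a : Z ⟶ W), g = b ≫ J.map a)
    {W : B} (hW : ∀ k : R ⟶ J.obj W, ∃ f : P ⟶ W, k = p ≫ J.map f) :
    Function.Surjective (L.map : (P ⟶ W) → _) := by
  intro φ
  obtain ⟨ψ, hψ⟩ := Localization.exists_leftFraction L S.trW φ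
  -- If `φ` is the fraction `ψ.s⁻¹ ∘ ψ.f`, the morphism `p ≫ ψ.f` lifts along `ψ.s`, whose cone is
  -- in `S`.
  obtain ⟨Z, z, c, hZT, hZ⟩ := (S.trW_iff ψ.s).1 ψ.hs
  obtain ⟨_, hZT'⟩ := exists_distTriang_map J hZT
  obtain ⟨k, hk⟩ := exists_lift_of_distTriang hZT' (p ≫ J.map ψ.f) (by
    rw [Category.assoc]
    exact hR Z hZ _)
  obtain ⟨f, rfl⟩ := hW k
  have h : L.map (ψ.f - f ≫ ψ.s) = 0 := by
    refine localization_map_eq_zero_of_comp_eq_zero' S L J hT hU _ ?_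
    rw [J.map_sub, Preadditive.comp_sub, sub_eq_zero, hk]
    simp
  have := Localization.inverts L S.trW ψ.s ψ.hs
  refine ⟨f, ?_⟩
  rw [hψ, ← cancel_mono (L.map ψ.s), MorphismProperty.LeftFraction.map_comp_map_s,
    ← L.map_comp, ← sub_eq_zero, ← L.map_sub, ← neg_sub, L.map_neg, h, neg_zero]

/-- In the situation of `localization_map_surjective_of_coresolution`, the morphisms `R ⟶ W` embed
in the morphisms `P ⟶ W` of the Verdier quotient. -/
lemma eq_zero_of_coresolution (hT : Triangle.mk j p d ∈ distTriang T)
    (hR : ∀ (Z : B), S Z → ∀ g : R ⟶ J.obj Z, g = 0)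
    (hU : ∀ (W : B) (g : U ⟶ J.obj W),
      ∃ (Z : B) (_ : S Z) (b : U ⟶ J.obj Z) (a : Z ⟶ W), g = b ≫ J.map a)
    {W : B} (hW : ∀ φ : L.obj P ⟶ L.obj W, φ = 0) (k : R ⟶ J.obj W) : k = 0 := by
  obtain ⟨Z, hZ, b, a, hab⟩ := hU W (j ≫ k)
  obtain ⟨W', t, c, hWT⟩ := distinguished_cocone_triangle a
  have hat : a ≫ t = 0 := comp_eq_zero_of_distTriang hWT
  obtain ⟨_, hWT'⟩ := exists_distTriang_map J hWT
  obtain ⟨f, hf⟩ := exists_desc_of_distTriang hT (k ≫ J.map t) (by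
    rw [← Category.assoc, hab, Category.assoc, ← J.map_comp, hat, J.map_zero, comp_zero])
  obtain ⟨f, rfl⟩ := J.map_surjective f
  have ht : S.trW t := ObjectProperty.trW.mk' S hWT hZ
  have := Localization.inverts L S.trW t ht
  have hLf : L.map f = 0 := by
    rw [← cancel_mono (inv (L.map t)), zero_comp]
    exact hW _
  obtain ⟨Z', hZ', a', b', rfl⟩ := (localization_map_eq_zero_iff S L f).1 hLf
  obtain ⟨k', rfl⟩ := exists_lift_of_distTriang hWT' k (by
    rw [hf, J.map_comp, ← Category.assoc, hR Z' hZ' (p ≫ J.map a'), zero_comp])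
  rw [hR Z hZ k', zero_comp]

end Coresolution

end VerdierHom

/-! ### Dévissage for fully faithful triangulated functors -/

section FullyFaithful

open Pretriangulated

variable {C D : Type*} [Category* C] [Category* D]

section Iso

variable (G : C ⥤ D)

lemma map_bijective_of_iso {W W' Y Y' : C} (e : W ≅ W') (e' : Y ≅ Y')
    (h : Function.Bijective (G.map : (W ⟶ Y) → _)) :
    Function.Bijective (G.map : (W' ⟶ Y') → _) := by
  refine ⟨fun f g hfg => ?_, fun g => ?_⟩
  · have := h.1 (a₁ := e.hom ≫ f ≫ e'.inv) (a₂ := e.hom ≫ g ≫ e'.inv) (by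
      simp only [Functor.map_comp, hfg])
    simpa using this
  · obtain ⟨f, hf⟩ := h.2 (G.map e.hom ≫ g ≫ G.map e'.inv)
    exact ⟨e.inv ≫ f ≫ e'.hom, by
      simp only [Functor.map_comp, hf, Category.assoc, Iso.map_inv_hom_id_assoc,
        Iso.map_inv_hom_id, Category.comp_id]⟩

lemma map_surjective_of_iso {W W' Y Y' : C} (e : W ≅ W') (e' : Y ≅ Y')
    (h : Function.Surjective (G.map : (W ⟶ Y) → _)) :
    Function.Surjective (G.map : (W' ⟶ Y') → _) := fun g => by
  obtain ⟨f, hf⟩ := h (G.map e.hom ≫ g ≫ G.map e'.inv)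
  exact ⟨e.inv ≫ f ≫ e'.hom, by
      simp only [Functor.map_comp, hf, Category.assoc, Iso.map_inv_hom_id_assoc,
        Iso.map_inv_hom_id, Category.comp_id]⟩

lemma map_shift_surjective [HasShift C ℤ] [HasShift D ℤ] [G.CommShift ℤ] {W Y : C} (n : ℤ)
    (h : Function.Surjective (G.map : (W ⟶ Y) → _)) :
    Function.Surjective (G.map : (W⟦n⟧ ⟶ Y⟦n⟧) → _) := fun g => by
  obtain ⟨g', hg'⟩ := (shiftFunctor D n).map_surjective
    ((G.commShiftIso n).inv.app W ≫ g ≫ (G.commShiftIso n).hom.app Y)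
  obtain ⟨f, rfl⟩ := h g'
  refine ⟨f⟦n⟧', ?_⟩
  rw [← cancel_mono ((G.commShiftIso n).hom.app Y), G.commShiftIso_hom_naturality, hg',
    Iso.hom_inv_id_app_assoc]

end Iso

variable [Preadditive C] [HasZeroObject C] [HasShift C ℤ]
  [∀ n : ℤ, (shiftFunctor C n).Additive] [Pretriangulated C]
  [Preadditive D] [HasZeroObject D] [HasShift D ℤ]
  [∀ n : ℤ, (shiftFunctor D n).Additive] [Pretriangulated D]
  (G : C ⥤ D) [G.CommShift ℤ] [G.IsTriangulated]

section FiveLemma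

variable {P Q R : C} {f : P ⟶ Q} {g : Q ⟶ R} {h : R ⟶ P⟦(1 : ℤ)⟧}

/-- The five lemma for the maps `Hom(W, -) ⟶ Hom(G W, G -)`. -/
lemma map_bijective_of_distTriang_right (hT : Triangle.mk f g h ∈ distTriang C) (W : C)
    (h₁ : Function.Bijective (G.map : (W ⟶ P) → _))
    (h₃ : Function.Bijective (G.map : (W ⟶ R) → _))
    (h₁' : Function.Injective (G.map : (W ⟶ P⟦(1 : ℤ)⟧) → _))
    (h₃' : Function.Surjective (G.map : (W ⟶ R⟦(-1 : ℤ)⟧) → _)) :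
    Function.Bijective (G.map : (W ⟶ Q) → _) := by
  obtain ⟨f', _, hT'⟩ := exists_distTriang_invRotate hT
  obtain ⟨_, hT₁⟩ := exists_distTriang_rotate hT
  obtain ⟨_, hGT⟩ := exists_distTriang_map G hT
  obtain ⟨_, hGT'⟩ := exists_distTriang_map G hT'
  have hGgh : G.map g ≫ G.map h = 0 := by
    rw [← G.map_comp, comp_eq_zero_of_distTriang hT₁, G.map_zero]
  constructor
  · refine (injective_iff_map_eq_zero (G.mapAddHom (X := W) (Y := Q))).2 fun k hk => ?_
    replace hk : G.map k = 0 := hk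
    obtain ⟨l, rfl⟩ := exists_lift_of_distTriang hT k
      (h₃.1 (by rw [G.map_comp, hk, zero_comp, G.map_zero]))
    obtain ⟨e, he⟩ := exists_lift_of_distTriang hGT' (G.map l) (by rw [← G.map_comp, hk])
    obtain ⟨e, rfl⟩ := h₃' e
    obtain rfl : l = e ≫ f' := h₁.1 (by rw [he, G.map_comp])
    rw [Category.assoc, comp_eq_zero_of_distTriang hT', comp_zero]
  · intro k
    obtain ⟨k₃, hk₃⟩ := h₃.2 (k ≫ G.map g)
    obtain ⟨k₂, rfl⟩ := exists_lift_of_distTriang hT₁ k₃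
      (h₁' (by rw [G.map_comp, hk₃, Category.assoc, hGgh, comp_zero, G.map_zero]))
    obtain ⟨l, hl⟩ := exists_lift_of_distTriang hGT (k - G.map k₂)
      (by rw [Preadditive.sub_comp, ← hk₃, G.map_comp, sub_self])
    obtain ⟨l, rfl⟩ := h₁.2 l
    exact ⟨k₂ + l ≫ f, by rw [G.map_add, G.map_comp, ← hl, add_sub_cancel]⟩

/-- The five lemma for the maps `Hom(-, Y) ⟶ Hom(G -, G Y)`. -/
lemma map_bijective_of_distTriang_left (hT : Triangle.mk f g h ∈ distTriang C) (Y : C)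
    (h₁ : Function.Bijective (G.map : (P ⟶ Y) → _))
    (h₃ : Function.Bijective (G.map : (R ⟶ Y) → _))
    (h₁' : Function.Surjective (G.map : (P⟦(1 : ℤ)⟧ ⟶ Y) → _))
    (h₃' : Function.Injective (G.map : (R⟦(-1 : ℤ)⟧ ⟶ Y) → _)) :
    Function.Bijective (G.map : (Q ⟶ Y) → _) := by
  obtain ⟨f', _, hT'⟩ := exists_distTriang_invRotate hT
  obtain ⟨_, hT₁⟩ := exists_distTriang_rotate hT
  obtain ⟨_, hGT⟩ := exists_distTriang_map G hT
  obtain ⟨_, hGT₁⟩ := exists_distTriang_map G hT₁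
  have hGff : G.map f' ≫ G.map f = 0 := by
    rw [← G.map_comp, comp_eq_zero_of_distTriang hT', G.map_zero]
  constructor
  · refine (injective_iff_map_eq_zero (G.mapAddHom (X := Q) (Y := Y))).2 fun k hk => ?_
    replace hk : G.map k = 0 := hk
    obtain ⟨l, rfl⟩ := exists_desc_of_distTriang hT k
      (h₁.1 (by rw [G.map_comp, hk, comp_zero, G.map_zero]))
    obtain ⟨e, he⟩ := exists_desc_of_distTriang hGT₁ (G.map l) (by rw [← G.map_comp, hk])
    obtain ⟨e, rfl⟩ := h₁' e
    obtain rfl : l = h ≫ e := h₃.1 (by rw [he, G.map_comp])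
    rw [← Category.assoc, comp_eq_zero_of_distTriang hT₁, zero_comp]
  · intro k
    obtain ⟨k₁, hk₁⟩ := h₁.2 (G.map f ≫ k)
    obtain ⟨k₂, rfl⟩ := exists_desc_of_distTriang hT' k₁
      (h₃' (by rw [G.map_comp, hk₁, ← Category.assoc, hGff, zero_comp, G.map_zero]))
    obtain ⟨l, hl⟩ := exists_desc_of_distTriang hGT (k - G.map k₂)
      (by rw [Preadditive.comp_sub, ← hk₁, G.map_comp, sub_self])
    obtain ⟨l, rfl⟩ := h₃.2 l
    exact ⟨k₂ + g ≫ l, by rw [G.map_add, G.map_comp, ← hl, add_sub_cancel]⟩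

end FiveLemma

/-- The objects `Y` such that `Hom(W, Y⟦k⟧) ⟶ Hom(G W, G Y⟦k⟧)` is bijective for all `k`. -/
def bijectiveFrom (W : C) : ObjectProperty C :=
  fun Y => ∀ k : ℤ, Function.Bijective (G.map : (W ⟶ Y⟦k⟧) → _)

/-- The objects `W` such that `Hom(W⟦k⟧, Y) ⟶ Hom(G W⟦k⟧, G Y)` is bijective for all `k`. -/
def bijectiveTo (Y : C) : ObjectProperty C :=
  fun W => ∀ k : ℤ, Function.Bijective (G.map : (W⟦k⟧ ⟶ Y) → _)

instance (W : C) : (bijectiveFrom G W).IsClosedUnderIsomorphisms where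
  of_iso e h k := map_bijective_of_iso G (Iso.refl _) ((shiftFunctor C k).mapIso e) (h k)

instance (Y : C) : (bijectiveTo G Y).IsClosedUnderIsomorphisms where
  of_iso e h k := map_bijective_of_iso G ((shiftFunctor C k).mapIso e) (Iso.refl _) (h k)

instance (W : C) : (bijectiveFrom G W).IsTriangulated where
  exists_zero := ⟨0, isZero_zero C, fun k => by
    have h := (shiftFunctor C k).map_isZero (isZero_zero C)
    exact ⟨fun _ _ _ => h.eq_of_tgt _ _, fun _ => ⟨0, (G.map_isZero h).eq_of_tgt _ _⟩⟩⟩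
  isStableUnderShiftBy n := ⟨fun Y hY k => map_bijective_of_iso G (Iso.refl _)
    ((shiftFunctorAdd C n k).app Y) (hY (n + k))⟩
  toIsTriangulatedClosed₂ := .mk' (fun Θ hΘ h₁ h₃ k =>
    map_bijective_of_distTriang_right G (Triangle.shift_distinguished _ hΘ k) W (h₁ k) (h₃ k)
      (map_bijective_of_iso G (Iso.refl _) ((shiftFunctorAdd C k 1).app Θ.obj₁) (h₁ (k + 1))).1
      (map_bijective_of_iso G (Iso.refl _) ((shiftFunctorAdd C k (-1)).app Θ.obj₃)
        (h₃ (k + -1))).2)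

instance (Y : C) : (bijectiveTo G Y).IsTriangulated where
  exists_zero := ⟨0, isZero_zero C, fun k => by
    have h := (shiftFunctor C k).map_isZero (isZero_zero C)
    exact ⟨fun _ _ _ => h.eq_of_src _ _, fun _ => ⟨0, (G.map_isZero h).eq_of_src _ _⟩⟩⟩
  isStableUnderShiftBy n := ⟨fun W hW k => map_bijective_of_iso G
    ((shiftFunctorAdd C n k).app W) (Iso.refl _) (hW (n + k))⟩
  toIsTriangulatedClosed₂ := .mk' (fun Θ hΘ h₁ h₃ k =>
    map_bijective_of_distTriang_left G (Triangle.shift_distinguished _ hΘ k) Y (h₁ k) (h₃ k)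
      (map_bijective_of_iso G ((shiftFunctorAdd C k 1).app Θ.obj₁) (Iso.refl _) (h₁ (k + 1))).2
      (map_bijective_of_iso G ((shiftFunctorAdd C k (-1)).app Θ.obj₃) (Iso.refl _)
        (h₃ (k + -1))).1)

end FullyFaithful

end BoundedHomotopy

namespace LowerExt

open BoundedHomotopy Pretriangulated

variable {A : Type u} [Category.{v} A] [Preadditive A]

/-! ### Lower extension groups as morphisms in the homotopy category -/

section Homology

variable [HasZeroObject A]

lemma exactAt_homFrom_iff (T : A) (K : CochainComplex A ℤ) (n : ℤ) :
    (homFrom T K).ExactAt n ↔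
      ∀ f : (HomotopyCategory.singleFunctor A n).obj T ⟶
        (HomotopyCategory.quotient A (ComplexShape.up ℤ)).obj K, f = 0 := by
  rw [single_hom_eq_zero_iff,
    HomologicalComplex.exactAt_iff' _ (n - 1) n (n + 1) (by simp) (by simp),
    ShortComplex.ab_exact_iff]
  rfl

/-- The index set of `homTo K T` has the reversed order, so its short complex in degree `n` runs from
degree `n + 1` to degree `n - 1`. -/
lemma exactAt_homTo_iff (T : A) (K : CochainComplex A ℤ) (n : ℤ) :
    (homTo K T).ExactAt n ↔
      ∀ f : (HomotopyCategory.quotient A (ComplexShape.up ℤ)).obj K ⟶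
        (HomotopyCategory.singleFunctor A n).obj T, f = 0 := by
  rw [hom_single_eq_zero_iff,
    HomologicalComplex.exactAt_iff' _ (n + 1) n (n - 1)
      ((ComplexShape.up ℤ).symm.prev_eq' (by simp)) ((ComplexShape.up ℤ).symm.next_eq' (by simp)),
    ShortComplex.ab_exact_iff]
  rfl

lemma isZero_lowerExt_inl_iff {X : ObjectProperty A} {P Q : A} (n : ℤ) (R : Resolution X Q) :
    IsZero (lowerExt X n (P := P) (.inl R)) ↔
      ∀ f : (HomotopyCategory.singleFunctor A (-n)).obj P ⟶
        (HomotopyCategory.quotient A (ComplexShape.up ℤ)).obj R.complex, f = 0 :=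
  (HomologicalComplex.exactAt_iff_isZero_homology _ _).symm.trans (exactAt_homFrom_iff _ _ _)

lemma isZero_lowerExt_inr_iff {X : ObjectProperty A} {P Q : A} (n : ℤ) (R : Coresolution X P) :
    IsZero (lowerExt X n (Q := Q) (.inr R)) ↔
      ∀ f : (HomotopyCategory.quotient A (ComplexShape.up ℤ)).obj R.complex ⟶
        (HomotopyCategory.singleFunctor A n).obj Q, f = 0 :=
  (HomologicalComplex.exactAt_iff_isZero_homology _ _).symm.trans (exactAt_homTo_iff _ _ _)

end Homology

/-! ### The subcategory `K^b(X)` of `K^b(A)` -/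

section KbSub

variable (X : ObjectProperty A)

instance : (KbSub X).IsClosedUnderIsomorphisms :=
  inferInstanceAs (mapKb X.ι).essImage.IsClosedUnderIsomorphisms

variable [HasZeroObject A]

/-- The stalk complexes of objects of `X` in the homotopy category. -/
def stalksOf : ObjectProperty (HomotopyCategory A (ComplexShape.up ℤ)) :=
  fun K => ∃ (n : ℤ) (T : A), X T ∧ Nonempty (K ≅ (HomotopyCategory.singleFunctor A n).obj T)

instance : (stalksOf X).IsStableUnderShift ℤ where
  isStableUnderShiftBy k := ⟨by
    rintro K ⟨n, T, hT, ⟨e⟩⟩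
    exact ⟨n - k, T, hT, ⟨(shiftFunctor _ k).mapIso e ≪≫
      ((HomotopyCategory.singleFunctors A).shiftIso k (n - k) n (by lia)).app T⟩⟩⟩

variable [HasBinaryBiproducts A]

/-- Dévissage in `K^b(X)`, inside the unbounded homotopy category. -/
lemma prop_of_kbSub (S : ObjectProperty (HomotopyCategory A (ComplexShape.up ℤ)))
    [S.IsTriangulated] [S.IsClosedUnderIsomorphisms] (hS : stalksOf X ≤ S) {Z : Kb A}
    (hZ : KbSub X Z) : S Z.obj := by
  obtain ⟨⟨⟨M⟩, a, b, ha, hb⟩, ⟨e⟩⟩ := hZ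
  refine S.prop_of_iso ((bounded A).ι.mapIso e) (prop_quotient_obj_of_single S
    ((X.ι.mapHomologicalComplex (ComplexShape.up ℤ)).obj M) a b
    (inferInstanceAs (CochainComplex.IsStrictlyGE
      ((X.ι.mapHomologicalComplex (ComplexShape.up ℤ)).obj M) a))
    (inferInstanceAs (CochainComplex.IsStrictlyLE
      ((X.ι.mapHomologicalComplex (ComplexShape.up ℤ)).obj M) b))
    fun i => hS _ ⟨i, _, (M.X i).property, ⟨Iso.refl _⟩⟩)

/-- A complex which receives no nonzero morphism from the stalk complexes of `X` receives none
from `K^b(X)`. -/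
lemma hom_eq_zero_of_rightOrthogonal {K : HomotopyCategory A (ComplexShape.up ℤ)}
    (hK : (stalksOf X).rightOrthogonal K) (Z : Kb A) (hZ : KbSub X Z)
    (f : (bounded A).ι.obj Z ⟶ K) : f = 0 :=
  prop_of_kbSub X (stalksOf X).rightOrthogonal.leftOrthogonal
    (fun _ hZ _ g hK => hK g hZ) hZ f hK

lemma hom_eq_zero_of_leftOrthogonal {K : HomotopyCategory A (ComplexShape.up ℤ)}
    (hK : (stalksOf X).leftOrthogonal K) (Z : Kb A) (hZ : KbSub X Z)
    (f : K ⟶ (bounded A).ι.obj Z) : f = 0 :=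
  prop_of_kbSub X (stalksOf X).leftOrthogonal.rightOrthogonal
    (fun _ hZ _ g hK => hK g hZ) hZ f hK

variable [HasZeroObject X.FullSubcategory] [HasBinaryBiproducts X.FullSubcategory]

omit [HasBinaryBiproducts A] [HasBinaryBiproducts X.FullSubcategory] in
lemma kbSub_stalk (n : ℤ) {T : A} (hT : X T) : KbSub X ((stalk A n).obj T) :=
  ⟨_, ⟨(stalkMapKbIso X.ι n).app ⟨T, hT⟩⟩⟩

lemma kbSub_kbOf (K : CochainComplex A ℤ) (hK : ∃ a b : ℤ, K.IsStrictlyGE a ∧ K.IsStrictlyLE b)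
    (h : ∀ i, X (K.X i) ∨ IsZero (K.X i)) : KbSub X (kbOf K hK) := by
  refine prop_kbOf_of_stalk _ K hK fun i => ?_
  obtain h | h := h i
  · exact kbSub_stalk X i h
  · exact (KbSub X).prop_of_isZero ((stalk A i).map_isZero h)

omit [HasBinaryBiproducts A] [HasZeroObject X.FullSubcategory]
  [HasBinaryBiproducts X.FullSubcategory] in
lemma cut_X_mem_or_isZero (K : CochainComplex A ℤ) (p : ℤ → Prop)
    (h : ∀ i, p i → X (K.X i) ∨ IsZero (K.X i)) (i : ℤ) :
    X ((cut K p).X i) ∨ IsZero ((cut K p).X i) := by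
  by_cases hi : p i
  · have : (cut K p).X i = K.X i := if_pos hi
    rw [this]
    exact h i hi
  · exact Or.inr (isZero_cut_X K p hi)

/-- A morphism from a bounded complex to a bounded above complex `K` with terms in `X` factors
through a bounded complex with terms in `X`, namely a brutal truncation of `K`. -/
lemma exists_factorization_right (K : CochainComplex A ℤ) (b : ℤ) (hb : K.IsStrictlyLE b)
    (h : ∀ i, X (K.X i) ∨ IsZero (K.X i)) (W : Kb A)
    {V : HomotopyCategory A (ComplexShape.up ℤ)}
    (e : V ≅ (HomotopyCategory.quotient A (ComplexShape.up ℤ)).obj K)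
    (g : (bounded A).ι.obj W ⟶ V) :
    ∃ (Z : Kb A) (_ : KbSub X Z) (f : W ⟶ Z) (f' : (bounded A).ι.obj Z ⟶ V),
      g = (bounded A).ι.map f ≫ f' := by
  have hg : g = (g ≫ e.hom) ≫ e.inv := by simp
  obtain ⟨⟨W⟩, a, c, ha, hc⟩ := W
  have h₁ : (cut K (a ≤ ·)).IsStrictlyGE a := cut_isStrictlyGE _ _ _ fun _ h => h
  have h₃ : (cut K (fun i => ¬ a ≤ i)).IsStrictlyLE (a - 1) :=
    cut_isStrictlyLE _ _ _ fun i h => by lia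
  obtain ⟨f, hf⟩ := exists_lift_of_distTriang (cutTriangle_distinguished K a) (g ≫ e.hom)
    (quotient_hom_eq_zero_of_lt (hK := ha) (hL := h₃) a (a - 1) (by lia) _)
  refine ⟨kbOf (cut K (a ≤ ·)) ⟨a, b, h₁, inferInstance⟩,
    kbSub_kbOf X _ _ (cut_X_mem_or_isZero X K _ fun i _ => h i), ObjectProperty.homMk f,
    (cutTriangle K a).mor₁ ≫ e.inv, ?_⟩
  exact hg.trans ((congrArg (· ≫ e.inv) hf).trans (Category.assoc _ _ _))

/-- A morphism from a bounded below complex `K` with terms in `X` to a bounded complex factors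
through a bounded complex with terms in `X`, namely a brutal truncation of `K`. -/
lemma exists_factorization_left (K : CochainComplex A ℤ) (a : ℤ) (ha : K.IsStrictlyGE a)
    (h : ∀ i, X (K.X i) ∨ IsZero (K.X i)) (W : Kb A)
    {U : HomotopyCategory A (ComplexShape.up ℤ)}
    (e : (HomotopyCategory.quotient A (ComplexShape.up ℤ)).obj K ≅ U)
    (g : U ⟶ (bounded A).ι.obj W) :
    ∃ (Z : Kb A) (_ : KbSub X Z) (f' : U ⟶ (bounded A).ι.obj Z) (f : Z ⟶ W),
      g = f' ≫ (bounded A).ι.map f := by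
  have hg : g = e.inv ≫ e.hom ≫ g := by simp
  obtain ⟨⟨W⟩, c, b, hc, hb⟩ := W
  have h₁ : (cut K (b + 1 ≤ ·)).IsStrictlyGE (b + 1) := cut_isStrictlyGE _ _ _ fun _ h => h
  have h₃ : (cut K (fun i => ¬ b + 1 ≤ i)).IsStrictlyLE b :=
    cut_isStrictlyLE _ _ _ fun i h => by lia
  obtain ⟨f, hf⟩ := exists_desc_of_distTriang (cutTriangle_distinguished K (b + 1))
    (e.hom ≫ g)
    (quotient_hom_eq_zero_of_lt (hK := h₁) (hL := hb) (b + 1) b (by lia) _)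
  refine ⟨kbOf (cut K (fun i => ¬ b + 1 ≤ i)) ⟨a, b, inferInstance, h₃⟩,
    kbSub_kbOf X _ _ (cut_X_mem_or_isZero X K _ fun i _ => h i),
    e.inv ≫ (cutTriangle K (b + 1)).mor₂, ObjectProperty.homMk f, ?_⟩
  exact hg.trans ((congrArg (e.inv ≫ ·) hf).trans (Category.assoc _ _ _).symm)

end KbSub

/-! ### Morphisms between stalk complexes in the Verdier quotient -/

section Stalks

variable {X : ObjectProperty A} [HasZeroObject A] [HasBinaryBiproducts A]

/-- The triangle `Q ⟶ X_Q ⟶ V ⟶` of a resolution `X_Q` of `Q`, where `V` is the part of `X_Q` in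
negative degrees. -/
lemma Resolution.exists_distTriang {Q : A} (R : Resolution X Q) :
    ∃ (i : (bounded A).ι.obj ((stalk A 0).obj Q) ⟶ (HomotopyCategory.quotient A _).obj R.complex)
      (p : (HomotopyCategory.quotient A _).obj R.complex ⟶
        (HomotopyCategory.quotient A _).obj (cut R.complex (fun i => ¬ 0 ≤ i)))
      (d : _ ⟶ _), Triangle.mk i p d ∈ distTriang _ := by
  have h₀ := R.isStrictlyLE
  have h₁ : (cut R.complex (0 ≤ ·)).IsStrictlyGE 0 := cut_isStrictlyGE _ _ _ fun _ h => h
  obtain ⟨e⟩ := exists_iso_stalk (cut R.complex (0 ≤ ·)) 0 ⟨0, 0, h₁, inferInstance⟩ h₁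
    inferInstance
  let e' := (bounded A).ι.mapIso (e ≪≫ (stalk A 0).mapIso (cutXIso R.complex (0 ≤ ·) le_rfl ≪≫
    R.iso))
  obtain ⟨d, hT⟩ := exists_distTriang_of_iso₁ (cutTriangle_distinguished R.complex 0) e'
  exact ⟨_, _, d, hT⟩

/-- The triangle `U ⟶ _PX ⟶ P ⟶` of a coresolution `_PX` of `P`, where `U` is the part of `_PX` in
positive degrees. -/
lemma Coresolution.exists_distTriang {P : A} (R : Coresolution X P) :
    ∃ (j : (HomotopyCategory.quotient A _).obj (cut R.complex (1 ≤ ·)) ⟶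
        (HomotopyCategory.quotient A _).obj R.complex)
      (p : (HomotopyCategory.quotient A _).obj R.complex ⟶
        (bounded A).ι.obj ((stalk A 0).obj P))
      (d : _ ⟶ _), Triangle.mk j p d ∈ distTriang _ := by
  have h₀ := R.isStrictlyGE
  have h₁ : (cut R.complex (fun i => ¬ 1 ≤ i)).IsStrictlyLE 0 :=
    cut_isStrictlyLE _ _ _ fun i h => by lia
  obtain ⟨e⟩ := exists_iso_stalk (cut R.complex (fun i => ¬ 1 ≤ i)) 0 ⟨0, 0, inferInstance, h₁⟩
    inferInstance h₁
  let e' := (bounded A).ι.mapIso (e ≪≫ (stalk A 0).mapIso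
    (cutXIso R.complex (fun i => ¬ 1 ≤ i) (by lia) ≪≫ R.iso))
  obtain ⟨d, hT⟩ := exists_distTriang_of_iso₃ (cutTriangle_distinguished R.complex 1) e'
  exact ⟨_, _, d, hT⟩

omit [HasBinaryBiproducts A] in
lemma Resolution.rightOrthogonal {Q : A} (R : Resolution X Q) :
    (stalksOf X).rightOrthogonal ((HomotopyCategory.quotient A _).obj R.complex) := by
  rintro K f ⟨n, T, hT, ⟨e⟩⟩
  rw [← cancel_epi e.inv, comp_zero]
  exact (exactAt_homFrom_iff T R.complex n).1 (R.acyclic T hT n) _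

omit [HasBinaryBiproducts A] in
lemma Coresolution.leftOrthogonal {P : A} (R : Coresolution X P) :
    (stalksOf X).leftOrthogonal ((HomotopyCategory.quotient A _).obj R.complex) := by
  rintro K f ⟨n, T, hT, ⟨e⟩⟩
  rw [← cancel_mono e.hom, zero_comp]
  exact (exactAt_homTo_iff T R.complex n).1 (R.acyclic T hT n) _

variable [HasZeroObject X.FullSubcategory] [HasBinaryBiproducts X.FullSubcategory]

/-- If `Ext_{X,n}(P, Q) = 0` for all `n ≥ 1`, then every morphism between stalk complexes
`P[-m] ⟶ Q` of the Verdier quotient comes from a morphism of `K^b(A)`. -/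
lemma Resolution.map_surjective {P Q : A} (R : Resolution X Q)
    (h : ∀ n : ℤ, 1 ≤ n → IsZero (lowerExt X n (P := P) (.inl R))) (m : ℤ) :
    Function.Surjective ((KbSub X).trW.Q.map :
      ((stalk A m).obj P ⟶ (stalk A 0).obj Q) → _) := by
  have h₀ := R.isStrictlyLE
  obtain ⟨i, p, d, hT⟩ := R.exists_distTriang
  have h₃ : (cut R.complex (fun i => ¬ 0 ≤ i)).IsStrictlyLE (-1) :=
    cut_isStrictlyLE _ _ _ fun i h => by lia
  have hX := cut_X_mem_or_isZero X R.complex (fun i => ¬ 0 ≤ i)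
    (fun i hi => Or.inl (R.mem i (by lia)))
  refine localization_map_surjective_of_resolution (KbSub X) _ (bounded A).ι hT
    (hom_eq_zero_of_rightOrthogonal X R.rightOrthogonal)
    (fun W g => exists_factorization_right X ((cut R.complex (fun i => ¬ 0 ≤ i))⟦(-1 : ℤ)⟧) 0
      (CochainComplex.isStrictlyLE_shift _ (-1) (-1) 0 (by lia)) (fun i => hX _) W
      (((HomotopyCategory.quotient A _).commShiftIso (-1 : ℤ)).symm.app _) g)
    (fun k => ?_)
  by_cases hm : 0 ≤ m
  -- In degrees `m ≥ 0`, a morphism `P[-m] ⟶ X_Q` lifts to `Q`, as it vanishes on the part of `X_Q`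
  -- in negative degrees.
  · obtain ⟨f, hf⟩ := exists_lift_of_distTriang hT k
      (quotient_hom_eq_zero_of_lt (K := (HomologicalComplex.single A (ComplexShape.up ℤ) m).obj P)
        m (-1) (by lia) _)
    exact ⟨ObjectProperty.homMk f, hf⟩
  -- In degrees `m < 0`, such a morphism is a class in `Ext_{X,-m}(P, Q)`.
  · have hk := (isZero_lowerExt_inl_iff (-m) R).1 (h (-m) (by lia))
    rw [neg_neg] at hk
    exact ⟨0, by rw [hk k, Functor.map_zero]; exact zero_comp.symm⟩

/-- `Ext_{X,n}(P, Q)` vanishes if there are no nonzero morphisms `P[n] ⟶ Q` in the Verdier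
quotient. -/
lemma Resolution.isZero_lowerExt {P Q : A} (R : Resolution X Q) (n : ℤ)
    (h : ∀ φ : (KbSub X).trW.Q.obj ((stalk A (-n)).obj P) ⟶
      (KbSub X).trW.Q.obj ((stalk A 0).obj Q), φ = 0) :
    IsZero (lowerExt X n (P := P) (.inl R)) := by
  have h₀ := R.isStrictlyLE
  obtain ⟨i, p, d, hT⟩ := R.exists_distTriang
  have hX := cut_X_mem_or_isZero X R.complex (fun i => ¬ 0 ≤ i)
    (fun i hi => Or.inl (R.mem i (by lia)))
  rw [isZero_lowerExt_inl_iff]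
  exact eq_zero_of_resolution (KbSub X) _ (bounded A).ι hT
    (hom_eq_zero_of_rightOrthogonal X R.rightOrthogonal)
    (exists_factorization_right X _ 0 inferInstance hX · (Iso.refl _)) h

/-- If `Ext_{X,n}(P, Q) = 0` for all `n ≥ 1`, then every morphism between stalk complexes
`P ⟶ Q[-m]` of the Verdier quotient comes from a morphism of `K^b(A)`. -/
lemma Coresolution.map_surjective {P Q : A} (R : Coresolution X P)
    (h : ∀ n : ℤ, 1 ≤ n → IsZero (lowerExt X n (Q := Q) (.inr R))) (m : ℤ) :
    Function.Surjective ((KbSub X).trW.Q.map :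
      ((stalk A 0).obj P ⟶ (stalk A m).obj Q) → _) := by
  have h₀ := R.isStrictlyGE
  obtain ⟨j, p, d, hT⟩ := R.exists_distTriang
  have h₁ : (cut R.complex (1 ≤ ·)).IsStrictlyGE 1 := cut_isStrictlyGE _ _ _ fun _ h => h
  have hX := cut_X_mem_or_isZero X R.complex (1 ≤ ·) (fun i hi => Or.inl (R.mem i (by lia)))
  refine localization_map_surjective_of_coresolution (KbSub X) _ (bounded A).ι hT
    (hom_eq_zero_of_leftOrthogonal X R.leftOrthogonal)
    (fun W g => exists_factorization_left X ((cut R.complex (1 ≤ ·))⟦(1 : ℤ)⟧) 0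
      (CochainComplex.isStrictlyGE_shift _ 1 1 0 (by lia)) (fun i => hX _) W
      (((HomotopyCategory.quotient A _).commShiftIso (1 : ℤ)).app _) g)
    (fun k => ?_)
  by_cases hm : m ≤ 0
  -- In degrees `m ≤ 0`, a morphism `_PX ⟶ Q[-m]` factors through `P`, as it vanishes on the part of
  -- `_PX` in positive degrees.
  · obtain ⟨f, hf⟩ := exists_desc_of_distTriang hT k
      (quotient_hom_eq_zero_of_lt (L := (HomologicalComplex.single A (ComplexShape.up ℤ) m).obj Q)
        1 m (by lia) _)
    exact ⟨ObjectProperty.homMk f, hf⟩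
  -- In degrees `m > 0`, such a morphism is a class in `Ext_{X,m}(P, Q)`.
  · have hk := (isZero_lowerExt_inr_iff m R).1 (h m (by lia))
    exact ⟨0, by rw [hk k, Functor.map_zero]; exact comp_zero.symm⟩

/-- `Ext_{X,n}(P, Q)` vanishes if there are no nonzero morphisms `P ⟶ Q[-n]` in the Verdier
quotient. -/
lemma Coresolution.isZero_lowerExt {P Q : A} (R : Coresolution X P) (n : ℤ)
    (h : ∀ φ : (KbSub X).trW.Q.obj ((stalk A 0).obj P) ⟶
      (KbSub X).trW.Q.obj ((stalk A n).obj Q), φ = 0) :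
    IsZero (lowerExt X n (Q := Q) (.inr R)) := by
  have h₀ := R.isStrictlyGE
  obtain ⟨j, p, d, hT⟩ := R.exists_distTriang
  have hX := cut_X_mem_or_isZero X R.complex (1 ≤ ·) (fun i hi => Or.inl (R.mem i (by lia)))
  rw [isZero_lowerExt_inr_iff]
  exact eq_zero_of_coresolution (KbSub X) _ (bounded A).ι hT
    (hom_eq_zero_of_leftOrthogonal X R.leftOrthogonal)
    (exists_factorization_left X _ 0 inferInstance hX · (Iso.refl _)) h

end Stalks

/-! ### The canonical functor -/

section CanonicalFunctor

variable {A : Type u} [Category.{v} A] [Preadditive A] (X : ObjectProperty A)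
  [HasZeroObject A] [HasBinaryBiproducts A]
  [HasZeroObject X.FullSubcategory] [HasBinaryBiproducts X.FullSubcategory]

noncomputable instance : Localization.Lifting (KbSub X).trW.Q (KbSub X).trW
    (mapKb (toFactor X)) (canonicalFunctor X) :=
  ⟨eqToIso (Localization.Construction.fac _ (inverts X))⟩

/-- The canonical functor is induced by the termwise projection. -/
noncomputable def canonicalFunctorIso :
    (KbSub X).trW.Q ⋙ canonicalFunctor X ≅ mapKb (toFactor X) :=
  Localization.Lifting.iso (KbSub X).trW.Q (KbSub X).trW _ _

noncomputable instance : (canonicalFunctor X).CommShift ℤ :=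
  Functor.commShiftOfLocalization (KbSub X).trW.Q (KbSub X).trW ℤ
    (mapKb (toFactor X)) (canonicalFunctor X)

instance : NatTrans.CommShift (canonicalFunctorIso X).hom ℤ :=
  inferInstanceAs (NatTrans.CommShift (Localization.Lifting.iso (KbSub X).trW.Q (KbSub X).trW
    (mapKb (toFactor X)) (canonicalFunctor X)).hom ℤ)

instance : (canonicalFunctor X).IsTriangulated :=
  have := Localization.essSurj_mapArrow (KbSub X).trW.Q (KbSub X).trW
  Functor.isTriangulated_of_precomp_iso (canonicalFunctorIso X)

lemma canonicalFunctor_map_Q_map {K K' : Kb A} (f : K ⟶ K') :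
    (canonicalFunctor X).map ((KbSub X).trW.Q.map f) = (canonicalFunctorIso X).hom.app K ≫
      (mapKb (toFactor X)).map f ≫ (canonicalFunctorIso X).inv.app K' := by
  rw [← NatTrans.naturality_assoc, Iso.hom_inv_id_app, Category.comp_id]
  rfl

/-- A morphism between stalk complexes which vanishes in `K^b(A/[X])` already vanishes in the
Verdier quotient: in equal degrees, it is a morphism of `A` which factors through an object of
`X`. -/
lemma Q_map_stalk_eq_zero {P Q : A} {m n : ℤ} (f : (stalk A m).obj P ⟶ (stalk A n).obj Q)
    (hf : (mapKb (toFactor X)).map f = 0) : (KbSub X).trW.Q.map f = 0 := by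
  by_cases hmn : m = n
  · subst hmn
    obtain ⟨f, rfl, hf₀⟩ := exists_of_mapKb_map_stalk_eq_zero (toFactor X) f hf
    rw [← (toFactor X).map_zero] at hf₀
    obtain ⟨T, hT, a, b, hab⟩ := (CategoryTheory.Quotient.functor_map_eq_iff _ _ _).1 hf₀
    exact (localization_map_eq_zero_iff (KbSub X) _ _).2 ⟨_, kbSub_stalk X m hT,
      (stalk A m).map a, (stalk A m).map b, by rw [← Functor.map_comp, ← hab, sub_zero]⟩
  · rw [stalk_hom_eq_zero hmn f, Functor.map_zero]

/-- If the canonical functor is faithful, then there are no nonzero morphisms in the Verdier quotient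
between stalk complexes in different degrees, as there are none in `K^b(A/[X])`. -/
lemma Q_hom_stalk_eq_zero [(canonicalFunctor X).Faithful] {P Q : A} {m n : ℤ} (hmn : m ≠ n)
    (φ : (KbSub X).trW.Q.obj ((stalk A m).obj P) ⟶ (KbSub X).trW.Q.obj ((stalk A n).obj Q)) :
    φ = 0 := by
  apply (canonicalFunctor X).map_injective
  obtain ⟨f, hf⟩ := mapKb_map_stalk_surjective (toFactor X) m n P Q
    ((canonicalFunctorIso X).inv.app _ ≫ (canonicalFunctor X).map φ ≫
      (canonicalFunctorIso X).hom.app _)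
  rw [stalk_hom_eq_zero hmn f, Functor.map_zero, eq_comm, Preadditive.IsIso.comp_left_eq_zero,
    Preadditive.IsIso.comp_right_eq_zero] at hf
  rw [hf, Functor.map_zero]

variable {X} in
/-- If the groups `Ext_{X,n}(P, Q)` vanish for `n ≥ 1`, then every morphism from `P` in degree `m` to
`Q` in degree `n` in the Verdier quotient comes from `K^b(A)`. -/
lemma Q_map_stalk_surjective {P Q : A} (E : Resolution X Q ⊕ Coresolution X P)
    (h : ∀ n : ℤ, 1 ≤ n → IsZero (lowerExt X n E)) (m n : ℤ) :
    Function.Surjective ((KbSub X).trW.Q.map :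
      ((stalk A m).obj P ⟶ (stalk A n).obj Q) → _) := by
  obtain R | R := E
  · exact map_surjective_of_iso _ (stalkShiftIso (-n) m (m - n) (by lia) P)
      (stalkShiftIso (-n) n 0 (by lia) Q) (map_shift_surjective _ (-n) (R.map_surjective h (m - n)))
  · exact map_surjective_of_iso _ (stalkShiftIso (-m) m 0 (by lia) P)
      (stalkShiftIso (-m) n (n - m) (by lia) Q)
      (map_shift_surjective _ (-m) (R.map_surjective h (n - m)))

/-- The canonical functor is bijective on the morphisms between two stalk complexes if those of the
Verdier quotient all come from `K^b(A)`. -/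
lemma canonicalFunctor_map_stalk_bijective {P Q : A} {m n : ℤ}
    (h : Function.Surjective ((KbSub X).trW.Q.map :
      ((stalk A m).obj P ⟶ (stalk A n).obj Q) → _)) :
    Function.Bijective ((canonicalFunctor X).map : ((KbSub X).trW.Q.obj ((stalk A m).obj P) ⟶
      (KbSub X).trW.Q.obj ((stalk A n).obj Q)) → _) := by
  constructor
  · refine (injective_iff_map_eq_zero ((canonicalFunctor X).mapAddHom
      (X := (KbSub X).trW.Q.obj ((stalk A m).obj P))
      (Y := (KbSub X).trW.Q.obj ((stalk A n).obj Q)))).2 fun φ hφ => ?_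
    obtain ⟨f, rfl⟩ := h φ
    refine Q_map_stalk_eq_zero X f ?_
    replace hφ : (canonicalFunctor X).map ((KbSub X).trW.Q.map f) = 0 := hφ
    rwa [canonicalFunctor_map_Q_map, Preadditive.IsIso.comp_left_eq_zero,
      Preadditive.IsIso.comp_right_eq_zero] at hφ
  · intro g
    obtain ⟨f, hf⟩ := mapKb_map_stalk_surjective (toFactor X) m n P Q
      ((canonicalFunctorIso X).inv.app _ ≫ g ≫ (canonicalFunctorIso X).hom.app _)
    exact ⟨(KbSub X).trW.Q.map f, by simp [canonicalFunctor_map_Q_map, hf]⟩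

/-- Stalk complexes in the Verdier quotient are stable under shifts. -/
noncomputable def QStalkShiftIso (n k : ℤ) (P : A) :
    ((KbSub X).trW.Q.obj ((stalk A n).obj P))⟦k⟧ ≅ (KbSub X).trW.Q.obj ((stalk A (n - k)).obj P) :=
  ((KbSub X).trW.Q.commShiftIso k).symm.app _ ≪≫
    (KbSub X).trW.Q.mapIso (stalkShiftIso k (n - k) n (by lia) P)

/-- The canonical functor is fully faithful as soon as it is so on stalk complexes. -/
lemma canonicalFunctor_map_bijective
    (h : ∀ (P Q : A) (m n : ℤ), Function.Bijective ((canonicalFunctor X).map :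
      ((KbSub X).trW.Q.obj ((stalk A m).obj P) ⟶
        (KbSub X).trW.Q.obj ((stalk A n).obj Q)) → _)) (W Y : VerdierQuotient X) :
    Function.Bijective ((canonicalFunctor X).map : (W ⟶ Y) → _) := by
  have h₁ (P : A) (m : ℤ) (Y : Kb A) : bijectiveFrom (canonicalFunctor X)
      ((KbSub X).trW.Q.obj ((stalk A m).obj P)) ((KbSub X).trW.Q.obj Y) :=
    prop_of_stalk ((bijectiveFrom (canonicalFunctor X)
      ((KbSub X).trW.Q.obj ((stalk A m).obj P))).inverseImage (KbSub X).trW.Q)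
      (fun Q n k => map_bijective_of_iso _ (Iso.refl _) (QStalkShiftIso X n k Q).symm
        (h P Q m (n - k))) Y
  have h₂ (W Y : Kb A) : bijectiveTo (canonicalFunctor X)
      ((KbSub X).trW.Q.obj Y) ((KbSub X).trW.Q.obj W) :=
    prop_of_stalk ((bijectiveTo (canonicalFunctor X)
      ((KbSub X).trW.Q.obj Y)).inverseImage (KbSub X).trW.Q)
      (fun P m k => map_bijective_of_iso _ (QStalkShiftIso X m k P).symm
        ((shiftFunctorZero _ ℤ).app _) (h₁ P (m - k) Y 0)) W
  exact map_bijective_of_iso _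
    ((shiftFunctorZero _ ℤ).app _ ≪≫ (KbSub X).trW.Q.objObjPreimageIso W)
    ((KbSub X).trW.Q.objObjPreimageIso Y) (h₂ _ _ 0)

/-- The essential image of a full triangulated functor is triangulated, and that of the canonical
functor contains the stalk complexes. -/
lemma canonicalFunctor_essSurj [(canonicalFunctor X).Full] : (canonicalFunctor X).EssSurj where
  mem_essImage K := prop_of_stalk (canonicalFunctor X).essImage
    (fun P i => ⟨_, ⟨(canonicalFunctorIso X).app ((stalk A i).obj P.as) ≪≫
      (stalkMapKbIso (toFactor X) i).app P.as⟩⟩) K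

end CanonicalFunctor

end LowerExt

/-- `A` is an additive category and `X` a full additive subcategory. The family `E` is an arbitrary
choice, for each pair of objects `P`, `Q`, of the `X`-resolution of `Q` or the `X`-coresolution of
`P` from which `Ext_{X,n}(P, Q)` is computed. -/
theorem proposition4p4 {A : Type u} [Category.{v} A] [Preadditive A]
    [HasZeroObject A] [HasBinaryBiproducts A] (X : ObjectProperty A)
    [HasZeroObject X.FullSubcategory] [HasBinaryBiproducts X.FullSubcategory]
    (h : (∀ B : A, Nonempty (LowerExt.Resolution X B)) ∨
      (∀ B : A, Nonempty (LowerExt.Coresolution X B)))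
    (E : ∀ P Q : A, LowerExt.Resolution X Q ⊕ LowerExt.Coresolution X P) :
    (LowerExt.canonicalFunctor X).IsEquivalence ↔
      ∀ n : ℤ, 1 ≤ n → ∀ P Q : A, IsZero (LowerExt.lowerExt X n (E P Q)) := by
  constructor
  · intro _ n hn P Q
    obtain R | R := E P Q
    · exact R.isZero_lowerExt n (LowerExt.Q_hom_stalk_eq_zero X (by lia))
    · exact R.isZero_lowerExt n (LowerExt.Q_hom_stalk_eq_zero X (by lia))
  · intro hE
    have hbij := LowerExt.canonicalFunctor_map_bijective X fun P Q m n =>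
      LowerExt.canonicalFunctor_map_stalk_bijective X
        (LowerExt.Q_map_stalk_surjective (E P Q) (fun k hk => hE k hk P Q) m n)
    have : (LowerExt.canonicalFunctor X).Faithful := ⟨fun h => (hbij _ _).1 h⟩
    have : (LowerExt.canonicalFunctor X).Full := ⟨(hbij _ _).2⟩
    have := LowerExt.canonicalFunctor_essSurj X
    exact {}
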